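/- Let $\Gamma_{\rm ref}\subset\mathbb R^2$ be a $C^3$-smooth Jordan curve (the image of a regular closed $C^3$ parametrization without self-intersections), let $O_*\supset\Gamma_{\rm ref}$ be open and connected, and let $\Phi:O_*\times[0,\infty)\to\mathbb R^2$ be of class $C^3$ such that, for every $t\ge 0$, $\Phi(\cdot,t)$ is one-to-one and its Jacobian matrix $\Phi'_q(\cdot,t)$ is everywhere invertible. Suppose that $\Phi$, its first, second and third derivatives, and $(\Phi'_q)^{-1}$ are bounded on $O_*\times[0,\infty)$. Put $\Gamma(t)=\Phi[\Gamma_{\rm ref},t]$. Notation. For a particle $\varrho=\Phi(q_*,t)\in\Gamma(t)$, $q_*\in\Gamma_{\rm ref}$, put $\varrho_\Gamma(\theta|t,\varrho)=\Phi(q_*,\theta)$, $V(\varrho,t)=\partial_t\Phi(q_*,t)$, $A(\varrho,t)=\partial_t^2\Phi(q_*,t)$. Let $s$ be the natural parameter (arc length) on $\Gamma(t)$ increasing counterclockwise (the area bounded by $\Gamma(t)$ is on the left), and let $f'_\varrho$ or $\partial f/\partial\varrho$ denote the derivative with respect to $s$ of a function on $\Gamma(t)$. Let $\tau(\varrho,t)$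 be the unit tangent vector in the direction of increasing $s$, $n=\tau^\perp$ its rotation through $+\pi/2$, $\varkappa$ the signed curvature ($\tau'_\varrho=\varkappa n$), and $V_n=\langle V,n\rangle$, $V_\tau=\langle V,\tau\rangle$, $A_n=\langle A,n\rangle$. Let $\pi(r,\theta)$ be the point of $\Gamma(\theta)$ nearest to $r$. Put $$\omega(\varrho,t)=\Big\langle \frac{d}{d\theta}\tau[\pi(\varrho,\theta),\theta]\Big|_{\theta=t},\,n(\varrho,t)\Big\rangle,\qquad \varsigma(\varrho,t)=\lim_{\theta\to t,\ \delta\to0}\frac{L_\theta[\varrho_\Gamma(\theta|t,\varrho)\to\varrho_\Gamma(\theta|t,\varrho_\delta)]-\delta}{(\theta-t)\,\delta},$$ where $L_\theta[p\to q]$ is the signed length (counted counterclockwise) of the shortest arc of $\Gamma(\theta)$ from $p$ to $q$, and $\varrho_\delta\in\Gamma(t)$ is the point at the signed arc length $\delta$ from $\varrho$. Times $\theta$ range over $[0,\infty)$, so at $t=0$ limits and derivatives in time are one-sided. Theorem. For every $t\ge0$ and every $\varrho\in\Gamma(t)$, the nearest point $\pi(\varrho',\theta)$ is unique for all $(\varrho',\theta)$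 near $(\varrho,t)$ with $\varrho'\in\Gamma(t)$, $\theta\ge 0$; the derivative $\frac{\partial\pi}{\partial\varrho}(\varrho,\theta)$ (for $\theta$ near $t$), the derivatives $V'_\varrho$ and $\omega'_\varrho$, the time derivative that defines $\omega$, and the limit that defines $\varsigma$ exist; and, as $\theta\to t$, with $V_n,V_\tau,A_n,\varkappa,\omega,\tau,n$ and their derivatives on the right evaluated at $(\varrho,t)$, $$\pi(\varrho,\theta)=\varrho+V_n\,n\,(\theta-t)+o(\theta-t),$$ $$\Big\|\frac{\partial\pi}{\partial\varrho}(\varrho,\theta)\Big\|-1=-\varkappa V_n(\theta-t)+o(\theta-t),$$ $$\varkappa[\pi(\varrho,\theta),\theta]=\varkappa+(\omega'_\varrho+\varkappa^2V_n)(\theta-t)+o(\theta-t),$$ $$V_n[\pi(\varrho,\theta),\theta]=V_n-(2\omega V_\tau-A_n+\varkappa V_\tau^2)(\theta-t)+o(\theta-t),$$ $$\varsigma(\varrho,t)=\langle\tau,V'_\varrho\rangle,\qquad \omega(\varrho,t)=\langle n,V'_\varrho\rangle-\varkappa V_\tau.$$ -/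

import Mathlib

open Set Filter Topology Asymptotics

noncomputable section

namespace PlanarCurve

/-- The Euclidean plane. -/
abbrev Plane : Type := EuclideanSpace ℝ (Fin 2)

/-- The vector `w` rotated counterclockwise through a right angle. -/
def rot (w : Plane) : Plane := !₂[-(w 1), w 0]

/-- A Jordan curve of class `C^3`: the trace of a regular closed parametrization of class `C^3`
without self-intersections. -/
def IsC3JordanCurve (Γ : Set Plane) : Prop :=
  ∃ γ : ℝ → Plane, ContDiff ℝ 3 γ ∧ Function.Periodic γ 1 ∧ (∀ u, deriv γ u ≠ 0) ∧
    InjOn γ (Ico 0 1) ∧ range γ = Γ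

/-- `p` lies in the area bounded by `Γ`: it is off `Γ`, and its connected component in the
complement of `Γ` is bounded. -/
def IsInside (Γ : Set Plane) (p : Plane) : Prop :=
  p ∉ Γ ∧ Bornology.IsBounded (connectedComponentIn Γᶜ p)

/-- `c` parametrizes the closed curve `Γ` by a natural parameter (arc length) that increases when
`Γ` is run counterclockwise, i.e., with the area bounded by `Γ` on the left. The natural parameter
is taken in `ℝ`, so that `c` is periodic and its period is the length of `Γ`. -/
structure IsNaturalParam (Γ : Set Plane) (c : ℝ → Plane) : Prop where
  contDiff : ContDiff ℝ 1 c
  unit_speed : ∀ s, ‖deriv c s‖ = 1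
  range_eq : range c = Γ
  closed_simple : ∃ l : ℝ, 0 < l ∧ Function.Periodic c l ∧ InjOn c (Ico 0 l)
  counterclockwise : ∀ s, ∀ᶠ ε in 𝓝[>] (0 : ℝ), IsInside Γ (c s + ε • rot (deriv c s))

/-! ### Geometry of a curve with natural parametrization `c` -/

/-- A value of the natural parameter at the point `r` of the curve. -/
def param (c : ℝ → Plane) (r : Plane) : ℝ := Function.invFun c r

/-- The derivative at `r` of a function on the curve with respect to the natural parameter. -/
def arcDeriv (c : ℝ → Plane) {F : Type*} [NormedAddCommGroup F] [NormedSpace ℝ F]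
    (f : Plane → F) (r : Plane) : F :=
  deriv (fun s => f (c s)) (param c r)

/-- A function on the curve is differentiable at `r` with respect to the natural parameter. -/
def ArcDifferentiableAt (c : ℝ → Plane) {F : Type*} [NormedAddCommGroup F] [NormedSpace ℝ F]
    (f : Plane → F) (r : Plane) : Prop :=
  DifferentiableAt ℝ (fun s => f (c s)) (param c r)

/-- The unit tangent vector that gives the counterclockwise orientation. -/
def tangent (c : ℝ → Plane) (r : Plane) : Plane := deriv c (param c r)

/-- The unit normal vector. -/
def normal (c : ℝ → Plane) (r : Plane) : Plane := rot (tangent c r)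

/-- The signed curvature. -/
def curvature (c : ℝ → Plane) (r : Plane) : ℝ :=
  inner ℝ (arcDeriv c (tangent c) r) (normal c r)

/-- The point of the curve at the signed arc length `δ` from `r`, counted counterclockwise. -/
def advance (c : ℝ → Plane) (r : Plane) (δ : ℝ) : Plane := c (param c r + δ)

/-- The signed lengths, counted counterclockwise, of the arcs that lead along the curve
from `p` to `q`. Any two of them differ by a multiple of the length of the curve. -/
def arcLengths (c : ℝ → Plane) (p q : Plane) : Set ℝ :=
  {l | ∃ a, c a = p ∧ c (a + l) = q}

open Classical in
/-- The signed length of the (shortest) arc from `p` to `q`, counted counterclockwise. -/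
def signedLength (c : ℝ → Plane) (p q : Plane) : ℝ :=
  if h : ∃ l ∈ arcLengths c p q, ∀ m ∈ arcLengths c p q, |l| ≤ |m| then h.choose else 0

/-- `p` is a point of `Γ` nearest to `r`. -/
def IsNearest (Γ : Set Plane) (r p : Plane) : Prop :=
  p ∈ Γ ∧ ∀ q ∈ Γ, dist r p ≤ dist r q

open Classical in
/-- The projection of `r` onto `Γ`: the point of `Γ` nearest to `r`. -/
def proj (Γ : Set Plane) (r : Plane) : Plane :=
  if h : ∃ p, IsNearest Γ r p then h.choose else 0

/-! ### The moving curve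

`G` is the reference configuration and `Φ q t` is the value of the configuration map. -/

/-- The standing assumptions on the reference configuration `G`, the configuration map `Φ` and
its spatial domain of definition `O`; time runs over `[0, ∞)`. -/
structure IsConfiguration (G O : Set Plane) (Φ : Plane → ℝ → Plane) : Prop where
  jordan : IsC3JordanCurve G
  isOpen : IsOpen O
  isConnected : IsConnected O
  subset : G ⊆ O
  contDiffOn : ContDiffOn ℝ 3 (fun z : Plane × ℝ => Φ z.1 z.2) (O ×ˢ Ici 0)
  injOn : ∀ t, 0 ≤ t → InjOn (fun q => Φ q t) O
  invertible : ∀ t, 0 ≤ t → ∀ q ∈ O, (fderiv ℝ (fun x => Φ x t) q).IsInvertible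
  bounded : ∃ C : ℝ, ∀ k : ℕ, k ≤ 3 → ∀ q ∈ O, ∀ t, 0 ≤ t →
    ‖iteratedFDerivWithin ℝ k (fun z : Plane × ℝ => Φ z.1 z.2) (O ×ˢ Ici 0) (q, t)‖ ≤ C
  inverse_bounded : ∃ C : ℝ, ∀ q ∈ O, ∀ t, 0 ≤ t →
    ‖(fderiv ℝ (fun x => Φ x t) q).inverse‖ ≤ C

/-- The current configuration `Γ(t)`. -/
def config (G : Set Plane) (Φ : Plane → ℝ → Plane) (t : ℝ) : Set Plane :=
  (fun q => Φ q t) '' G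

/-- The seed in `G` of the particle that is at `r` at time `t`. -/
def seed (G : Set Plane) (Φ : Plane → ℝ → Plane) (t : ℝ) (r : Plane) : Plane :=
  Function.invFunOn (fun q => Φ q t) G r

/-- The location at time `θ` of the particle that is at `r` at time `t`. -/
def location (G : Set Plane) (Φ : Plane → ℝ → Plane) (t : ℝ) (r : Plane) (θ : ℝ) : Plane :=
  Φ (seed G Φ t r) θ

/-- The velocity `V(r, t)`. -/
def velocity (G : Set Plane) (Φ : Plane → ℝ → Plane) (t : ℝ) (r : Plane) : Plane :=
  derivWithin (location G Φ t r) (Ici 0) t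

/-- The acceleration `A(r, t)`. -/
def acceleration (G : Set Plane) (Φ : Plane → ℝ → Plane) (t : ℝ) (r : Plane) : Plane :=
  iteratedDerivWithin 2 (location G Φ t r) (Ici 0) t

/-- The normal velocity `V_n(r, t)`; `c t` is a natural parametrization of `Γ(t)`. -/
def normalVelocity (G : Set Plane) (Φ : Plane → ℝ → Plane) (c : ℝ → ℝ → Plane)
    (t : ℝ) (r : Plane) : ℝ :=
  inner ℝ (velocity G Φ t r) (normal (c t) r)

/-- The tangential velocity `V_τ(r, t)`. -/
def tangentialVelocity (G : Set Plane) (Φ : Plane → ℝ → Plane) (c : ℝ → ℝ → Plane)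
    (t : ℝ) (r : Plane) : ℝ :=
  inner ℝ (velocity G Φ t r) (tangent (c t) r)

/-- The normal acceleration `A_n(r, t)`. -/
def normalAcceleration (G : Set Plane) (Φ : Plane → ℝ → Plane) (c : ℝ → ℝ → Plane)
    (t : ℝ) (r : Plane) : ℝ :=
  inner ℝ (acceleration G Φ t r) (normal (c t) r)

/-- The unit tangent to `Γ(θ)` at the projection of `r` onto `Γ(θ)`, as a function of `θ`. -/
def projectedTangent (G : Set Plane) (Φ : Plane → ℝ → Plane) (c : ℝ → ℝ → Plane)
    (r : Plane) (θ : ℝ) : Plane :=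
  tangent (c θ) (proj (config G Φ θ) r)

/-- The angular velocity at which the curve rotates at its point `r` at time `t`. -/
def angularVelocity (G : Set Plane) (Φ : Plane → ℝ → Plane) (c : ℝ → ℝ → Plane)
    (t : ℝ) (r : Plane) : ℝ :=
  inner ℝ (derivWithin (projectedTangent G Φ c r) (Ici 0) t) (normal (c t) r)

/-- `σ` is the rate of stretch of the moving curve at its point `r` at time `t`: the double limit,
as `θ → t` and `δ → 0`, of the relative elongation, per unit of time, of the arc that at time `t`
starts at `r` and has the signed length `δ`. -/
def HasStretchRate (G : Set Plane) (Φ : Plane → ℝ → Plane) (c : ℝ → ℝ → Plane)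
    (t : ℝ) (r : Plane) (σ : ℝ) : Prop :=
  Tendsto
    (fun z : ℝ × ℝ =>
      (signedLength (c z.1) (location G Φ t r z.1)
          (location G Φ t (advance (c t) r z.2) z.1) - z.2) / ((z.1 - t) * z.2))
    (𝓝[Ici 0 \ {t}] t ×ˢ 𝓝[≠] 0) (𝓝 σ)

end PlanarCurve

end

/-! Everything is computed in a Lagrangian parameter. Composing `Φ` with a parametrization of the
reference curve and extending the result across `θ = 0` gives a `C^3` map `F (u, θ)`
(`IsConfiguration.exists_isMotion`), so one-sided time derivatives at `0` become restrictions of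
ordinary ones. Write `m = |F_u|`. Once `u` is known to run counterclockwise at all times, which the
rightmost points of the curves decide (`IsMotion.sign_const`), the arc derivative is `m⁻¹ ∂_u`
(`IsOrientedMotion.hasDerivAt_arc`), and all geometric quantities become explicit expressions in the
partial derivatives of `F`.

The point of `Γ(θ)` nearest to `F (x, t)` is `F (U, θ)`, where `U (x, θ)` solves `⟨F (U, θ) - F (x,
t), F_u (U, θ)⟩ = 0`. The derivative of the left side in `U` at the base point is `m² ≠ 0`, so the
implicit function theorem applies; compactness shows that true nearest points are given by this
local solution (`IsMotion.exists_isProjParam`). Differentiating the equation gives `U_θ = -V_τ / m`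
at `θ = t`: relative to the particles, the projection slides back with the tangential velocity.
Hence a quantity `Q` followed along the projection changes at the rate `Q_θ - (V_τ / m) Q_u`. This
yields the expansions of position, tangent, curvature and normal velocity; for the curvature one
also needs `ω'_ϱ = κ_θ - (V_τ / m) κ_u - κ² V_n` (`IsOrientedMotion.hasDerivAt_angularVelocity`).
The stretch of the projection comes from the derivative of the same equation in `x`.

The rate of stretch is a genuine double limit, obtained by two mean value inequalities, one in time
and one in arc length (`IsOrientedMotion.hasStretchRate`). -/

namespace PlanarCurve

/-! ### Smooth extension across time zero -/

/-- The function `f` on the half-plane `θ ≥ 0`, extended to `θ < 0` by a weighted sum of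
reflections. -/
noncomputable def reflect {F : Type*} [NormedAddCommGroup F] [NormedSpace ℝ F]
    {ι : Type*} [Fintype ι] (l a : ι → ℝ) (f : ℝ × ℝ → F) (z : ℝ × ℝ) : F :=
  if 0 ≤ z.2 then f z else ∑ j, a j • f (z.1, l j * z.2)

section reflect

variable {F : Type*} [NormedAddCommGroup F] [NormedSpace ℝ F] {ι : Type*} [Fintype ι]

theorem reflect_of_nonneg (l a : ι → ℝ) (f : ℝ × ℝ → F) {z : ℝ × ℝ} (hz : 0 ≤ z.2) :
    reflect l a f z = f z := if_pos hz

theorem reflect_of_nonpos {l a : ι → ℝ} (ha : ∑ j, a j = 1) (f : ℝ × ℝ → F) {z : ℝ × ℝ}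
    (hz : z.2 ≤ 0) : reflect l a f z = ∑ j, a j • f (z.1, l j * z.2) := by
  rcases hz.lt_or_eq with h | h
  · exact if_neg (not_le.2 h)
  · obtain ⟨x, y⟩ := z
    obtain rfl : y = 0 := h
    simp [reflect, ← Finset.sum_smul, ha]

theorem hasFDerivAt_of_halfPlanes {g : ℝ × ℝ → F} {g' : ℝ × ℝ →L[ℝ] F} {z : ℝ × ℝ}
    (h₁ : 0 ≤ z.2 → HasFDerivWithinAt g g' {z | 0 ≤ z.2} z)
    (h₂ : z.2 ≤ 0 → HasFDerivWithinAt g g' {z | z.2 ≤ 0} z) : HasFDerivAt g g' z := by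
  have c₁ : IsClosed {z : ℝ × ℝ | 0 ≤ z.2} := isClosed_le continuous_const continuous_snd
  have c₂ : IsClosed {z : ℝ × ℝ | z.2 ≤ 0} := isClosed_le continuous_snd continuous_const
  have h₁' : HasFDerivWithinAt g g' {z | 0 ≤ z.2} z := by
    by_cases h : 0 ≤ z.2
    · exact h₁ h
    -- A closed half-plane that misses `z` imposes no condition on the derivative at `z`.
    · exact .of_notMem_closure (by rwa [c₁.closure_eq])
  have h₂' : HasFDerivWithinAt g g' {z | z.2 ≤ 0} z := by
    by_cases h : z.2 ≤ 0
    · exact h₂ h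
    · exact .of_notMem_closure (by rwa [c₂.closure_eq])
  have := h₁'.union h₂'
  rwa [show {z : ℝ × ℝ | 0 ≤ z.2} ∪ {z | z.2 ≤ 0} = univ from
    eq_univ_of_forall fun z => le_total 0 z.2, hasFDerivWithinAt_univ] at this

theorem uniqueDiffOn_halfPlane : UniqueDiffOn ℝ {z : ℝ × ℝ | 0 ≤ z.2} := by
  have : {z : ℝ × ℝ | 0 ≤ z.2} = univ ×ˢ Ici 0 := by ext; simp
  rw [this]
  exact uniqueDiffOn_univ.prod (uniqueDiffOn_Ici 0)

/-- The moment conditions make the derivatives from both sides match on the boundary line.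
Differentiation in the second variable turns the weights `a j` into `a j * l j` and shifts these
conditions by one. The two partial derivatives therefore carry different weights and are handled
separately, which is why `a` and `f` vary in the induction. -/
theorem contDiff_reflect {l : ι → ℝ} (hl : ∀ j, l j ≤ 0) (n : ℕ) :
    ∀ (a : ι → ℝ) (f : ℝ × ℝ → F), ContDiffOn ℝ n f {z : ℝ × ℝ | 0 ≤ z.2} →
      (∀ k ≤ n, ∑ j, a j * l j ^ k = 1) → ContDiff ℝ n (reflect l a f) := by
  have hmaps : ∀ j, MapsTo (fun z : ℝ × ℝ => (z.1, l j * z.2)) {z | z.2 ≤ 0} {z | 0 ≤ z.2} :=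
    fun j z hz => mul_nonneg_of_nonpos_of_nonpos (hl j) hz
  induction n with
  | zero =>
    intro a f hf ha
    have ha0 : ∑ j, a j = 1 := by simpa using ha 0 le_rfl
    have hf : ContinuousOn f {z : ℝ × ℝ | 0 ≤ z.2} := by simpa using hf.continuousOn
    have c₁ : IsClosed {z : ℝ × ℝ | 0 ≤ z.2} := isClosed_le continuous_const continuous_snd
    have c₂ : IsClosed {z : ℝ × ℝ | z.2 ≤ 0} := isClosed_le continuous_snd continuous_const
    have h₁ : ContinuousOn (reflect l a f) {z | 0 ≤ z.2} :=
      hf.congr fun z hz => reflect_of_nonneg l a f hz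
    have h₂ : ContinuousOn (reflect l a f) {z | z.2 ≤ 0} := by
      refine ContinuousOn.congr ?_ fun z hz => reflect_of_nonpos ha0 f hz
      refine continuousOn_finsetSum _ fun j _ => ContinuousOn.const_smul ?_ _
      exact hf.comp (by fun_prop) (hmaps j)
    have := h₁.union_of_isClosed h₂ c₁ c₂
    rw [show {z : ℝ × ℝ | 0 ≤ z.2} ∪ {z | z.2 ≤ 0} = univ from
      eq_univ_of_forall fun z => le_total 0 z.2, continuousOn_univ] at this
    exact contDiff_zero.2 this
  | succ n ih =>
    intro a f hf ha
    have ha0 : ∑ j, a j = 1 := by simpa using ha 0 (Nat.zero_le _)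
    have ha1 : ∑ j, a j * l j = 1 := by simpa using ha 1 (by omega)
    set S : Set (ℝ × ℝ) := {z : ℝ × ℝ | 0 ≤ z.2} with hS
    have hf' : ContDiffOn ℝ n (fderivWithin ℝ f S) S :=
      hf.fderivWithin uniqueDiffOn_halfPlane (by norm_cast)
    have hp : ∀ v : ℝ × ℝ, ContDiffOn ℝ n (fun z => fderivWithin ℝ f S z v) S :=
      fun v => hf'.clm_apply contDiffOn_const
    have h₁ := ih a _ (hp (1, 0)) fun k hk => ha k (by omega)
    have h₂ := ih (fun j => a j * l j) _ (hp (0, 1)) fun k hk => by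
      simpa [mul_assoc, pow_succ'] using ha (k + 1) (by omega)
    push_cast
    refine contDiff_succ_iff_hasFDerivAt.2 ⟨fun z =>
      (ContinuousLinearMap.fst ℝ ℝ ℝ).smulRight
        (reflect l a (fun z => fderivWithin ℝ f S z (1, 0)) z) +
      (ContinuousLinearMap.snd ℝ ℝ ℝ).smulRight
        (reflect l (fun j => a j * l j) (fun z => fderivWithin ℝ f S z (0, 1)) z), ?_, ?_⟩
    · exact (contDiff_const.smulRight h₁).add (contDiff_const.smulRight h₂)
    · intro z
      have hd : ∀ z ∈ S, HasFDerivWithinAt f (fderivWithin ℝ f S z) S z := fun z hz =>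
        ((hf.differentiableOn (by simp)) z hz).hasFDerivWithinAt
      have hsplit : ∀ (T : ℝ × ℝ →L[ℝ] F) (x : ℝ × ℝ), T x = x.1 • T (1, 0) + x.2 • T (0, 1) := by
        intro T x
        rw [← map_smul, ← map_smul, ← map_add]
        simp
      refine hasFDerivAt_of_halfPlanes (fun hz => ?_) fun hz => ?_
      · have := (hd z hz).congr (fun w hw => reflect_of_nonneg l a f hw)
          (reflect_of_nonneg l a f hz)
        convert! this using 1
        refine ContinuousLinearMap.ext fun x => ?_
        rw [hsplit (fderivWithin ℝ f S z) x]
        simp [reflect_of_nonneg, hz]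
      · have key : HasFDerivWithinAt (fun w : ℝ × ℝ => ∑ j, a j • f (w.1, l j * w.2))
            (∑ j, a j • (fderivWithin ℝ f S (z.1, l j * z.2)).comp
              ((ContinuousLinearMap.fst ℝ ℝ ℝ).prod (l j • ContinuousLinearMap.snd ℝ ℝ ℝ)))
            {z | z.2 ≤ 0} z := by
          refine HasFDerivWithinAt.fun_sum fun j _ => HasFDerivWithinAt.const_smul ?_ _
          refine HasFDerivWithinAt.comp (t := S) z (hd _ (hmaps j hz)) ?_ (hmaps j)
          exact (hasFDerivWithinAt_fst).prodMk (hasFDerivWithinAt_snd.const_mul _)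
        have := key.congr (fun w hw => reflect_of_nonpos ha0 f hw) (reflect_of_nonpos ha0 f hz)
        convert! this using 1
        refine ContinuousLinearMap.ext fun x => ?_
        simp only [add_apply, ContinuousLinearMap.smulRight_apply,
          sum_apply, smul_apply,
          ContinuousLinearMap.comp_apply, ContinuousLinearMap.coe_fst',
          ContinuousLinearMap.coe_snd', ContinuousLinearMap.prod_apply]
        rw [reflect_of_nonpos ha0 _ hz, reflect_of_nonpos ha1 _ hz, Finset.smul_sum,
          Finset.smul_sum, ← Finset.sum_add_distrib]
        refine Finset.sum_congr rfl fun j _ => ?_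
        rw [hsplit _ (x.1, l j • x.2)]
        simp only [smul_add, smul_smul, smul_eq_mul]
        congr 2 <;> ring

end reflect

theorem exists_contDiff_extension {F : Type*} [NormedAddCommGroup F] [NormedSpace ℝ F]
    {f : ℝ × ℝ → F} (hf : ContDiffOn ℝ 3 f {z : ℝ × ℝ | 0 ≤ z.2}) :
    ∃ g : ℝ × ℝ → F, ContDiff ℝ 3 g ∧ ∀ z : ℝ × ℝ, 0 ≤ z.2 → g z = f z := by
  -- The weights solve the Vandermonde system `∑ a j * l j ^ k = 1`, `k ≤ 3`, with nodes `-1, -2,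
  -- -3, -4`.
  refine ⟨reflect ![-1, -2, -3, -4] ![10, -20, 15, -4] f, ?_, fun z hz => reflect_of_nonneg _ _ _ hz⟩
  refine contDiff_reflect (n := 3) ?_ _ f hf ?_
  · intro j
    fin_cases j <;> simp
  · intro k hk
    interval_cases k <;> simp [Fin.sum_univ_succ] <;> norm_num

/-! ### Passing from arc length to a given regular parameter -/

section lift

variable {E : Type*} [NormedAddCommGroup E] [InnerProductSpace ℝ E]

-- By compactness, `f` embeds the circle `ℝ / ℤ` as a closed set; through this embedding `c` becomes
-- a continuous map into the circle, and it lifts along the covering `ℝ → ℝ / ℤ`.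
omit [InnerProductSpace ℝ E] in
theorem exists_continuous_lift {f c : ℝ → E} (hf : Continuous f) (hper : Function.Periodic f 1)
    (hinj : ∀ u u', f u = f u' → ∃ k : ℤ, u' = u + k) (hc : Continuous c)
    (hr : range c ⊆ range f) : ∃ w : ℝ → ℝ, Continuous w ∧ ∀ s, f (w s) = c s := by
  have : Fact ((0 : ℝ) < 1) := ⟨one_pos⟩
  have hemb : IsClosedEmbedding hper.lift := by
    refine Continuous.isClosedEmbedding ?_ ?_
    · exact continuous_coinduced_dom.2 hf
    · intro x y
      induction x using QuotientAddGroup.induction_on with | _ u => ?_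
      induction y using QuotientAddGroup.induction_on with | _ u' => ?_
      intro h
      obtain ⟨k, rfl⟩ := hinj u u' h
      have hk : ((k : ℝ) : AddCircle (1 : ℝ)) = 0 := (AddCircle.coe_eq_zero_iff 1).2 ⟨k, by simp⟩
      exact (by rw [AddCircle.coe_add, hk, add_zero] :
        (u : AddCircle (1 : ℝ)) = ((u + k : ℝ) : AddCircle (1 : ℝ)))
  choose χ hχ using fun s => hr ⟨s, rfl⟩
  have hcont : Continuous fun s => (χ s : AddCircle (1 : ℝ)) := by
    rw [hemb.isInducing.continuous_iff]
    convert! hc using 1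
    exact funext hχ
  obtain ⟨w, ⟨-, hw⟩, -⟩ := (AddCircle.isCoveringMap_coe (1 : ℝ)).existsUnique_continuousMap_lifts
    ⟨_, hcont⟩ 0 (χ 0) rfl
  refine ⟨w, w.continuous, fun s => ?_⟩
  have h1 : ((w s : ℝ) : AddCircle (1 : ℝ)) = χ s := congrFun hw s
  rw [← hχ s]
  have := congrArg hper.lift h1
  exact this

/-- The projection of `f` onto its own velocity at `w s` is a scalar function with nonzero
derivative; its local inverse recovers `w` from the same projection of `c`. -/
theorem differentiableAt_of_comp {f c : ℝ → E} {w : ℝ → ℝ} {s : ℝ} (hf : ContDiff ℝ 1 f)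
    (hf' : deriv f (w s) ≠ 0) (hc : DifferentiableAt ℝ c s) (hw : ContinuousAt w s)
    (h : ∀ᶠ x in 𝓝 s, f (w x) = c x) : DifferentiableAt ℝ w s := by
  set v := deriv f (w s) with hv
  have hφ : HasStrictDerivAt (fun u => inner ℝ (f u) v) (inner ℝ v v) (w s) := by
    have h1 : HasDerivAt (fun u => inner ℝ (f u) v) (inner ℝ v v) (w s) := by
      simpa only [inner_zero_right, zero_add, ← hv] using
        (hf.differentiable one_ne_zero (w s)).hasDerivAt.inner ℝ (hasDerivAt_const (w s) v)
    have h2 : ContDiff ℝ 1 (fun u => (inner ℝ (f u) v : ℝ)) := hf.inner ℝ contDiff_const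
    exact h2.contDiffAt.hasStrictDerivAt' h1 one_ne_zero
  have hne : (inner ℝ v v : ℝ) ≠ 0 := inner_self_ne_zero.2 hf'
  have hg := hφ.to_localInverse hne
  set g := hφ.localInverse _ _ _ hne
  have hleft : ∀ᶠ u in 𝓝 (w s), g (inner ℝ (f u) v) = u := 
    (hφ.hasStrictFDerivAt_equiv hne).eventually_left_inverse
  have h2 : DifferentiableAt ℝ (fun x => g (inner ℝ (c x) v)) s := by
    have h3 : DifferentiableAt ℝ g (inner ℝ (c s) v) := by
      rw [← h.self_of_nhds]; exact hg.hasDerivAt.differentiableAt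
    exact h3.comp s (hc.inner ℝ (differentiableAt_const v))
  refine h2.congr_of_eventuallyEq ?_
  filter_upwards [h, hw.eventually hleft] with x hx hx'
  rw [← hx, hx']

theorem exists_lift {f c : ℝ → E} (hf : ContDiff ℝ 1 f) (hper : Function.Periodic f 1)
    (hf' : ∀ u, deriv f u ≠ 0)
    (hinj : ∀ u u', f u = f u' → ∃ k : ℤ, u' = u + k) (hc : ContDiff ℝ 1 c)
    (hc' : ∀ s, ‖deriv c s‖ = 1) (hr : range c ⊆ range f) :
    ∃ (w : ℝ → ℝ) (ε : ℝ), (ε = 1 ∨ ε = -1) ∧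
      ∀ s, f (w s) = c s ∧ HasDerivAt w (ε / ‖deriv f (w s)‖) s := by
  obtain ⟨w, hw, h⟩ := exists_continuous_lift hf.continuous hper hinj hc.continuous hr
  have hd : ∀ s, DifferentiableAt ℝ w s := fun s =>
    differentiableAt_of_comp hf (hf' _) (hc.differentiable one_ne_zero s) hw.continuousAt
      (.of_forall h)
  have hdc : ∀ s, deriv c s = deriv w s • deriv f (w s) := by
    intro s
    have h1 : HasDerivAt (fun x => f (w x)) (deriv w s • deriv f (w s)) s :=
      ((hf.differentiable one_ne_zero (w s)).hasDerivAt).scomp s (hd s).hasDerivAt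
    rw [← h1.deriv]
    congr 1
    exact funext fun x => (h x).symm
  have hpos : ∀ s, 0 < ‖deriv f (w s)‖ := fun s => norm_pos_iff.2 (hf' _)
  have hsq : ∀ s, (deriv w s * ‖deriv f (w s)‖) ^ 2 = 1 := by
    intro s
    have := hc' s
    rw [hdc, norm_smul, Real.norm_eq_abs] at this
    rw [mul_pow, ← sq_abs (deriv w s), ← mul_pow, this, one_pow]
  -- Continuity of `deriv w` is not known beforehand, so the product is expressed through `deriv c`
  -- and `deriv f`. Being continuous with square `1`, it is a constant sign.
  have hcont : Continuous fun s => deriv w s * ‖deriv f (w s)‖ := by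
    have h1 : (fun s => deriv w s * ‖deriv f (w s)‖) =
        fun s => inner ℝ (deriv c s) (deriv f (w s)) / ‖deriv f (w s)‖ := by
      funext s
      rw [hdc, real_inner_smul_left, real_inner_self_eq_norm_sq]
      have := (hpos s).ne'
      field_simp
    rw [h1]
    have h2 : Continuous fun s => deriv f (w s) := (hf.continuous_deriv le_rfl).comp hw
    exact ((hc.continuous_deriv le_rfl).inner h2).div h2.norm fun s => (hpos s).ne'
  rcases isPreconnected_univ.eq_one_or_eq_neg_one_of_sq_eq hcont.continuousOn
    (fun s _ => hsq s) with h1 | h1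
  · refine ⟨w, 1, .inl rfl, fun s => ⟨h s, ?_⟩⟩
    rw [← show deriv w s * ‖deriv f (w s)‖ = 1 from h1 (mem_univ s),
      mul_div_cancel_right₀ _ (hpos s).ne']
    exact (hd s).hasDerivAt
  · refine ⟨w, -1, .inr rfl, fun s => ⟨h s, ?_⟩⟩
    rw [← show deriv w s * ‖deriv f (w s)‖ = -1 from h1 (mem_univ s),
      mul_div_cancel_right₀ _ (hpos s).ne']
    exact (hd s).hasDerivAt

end lift

/-! ### Partial derivatives in the parameter and in time -/

section partials

variable {E : Type*} [NormedAddCommGroup E] [NormedSpace ℝ E]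

/-- The partial derivative in the first variable. -/
noncomputable def d1 (f : ℝ × ℝ → E) (z : ℝ × ℝ) : E := fderiv ℝ f z (1, 0)

/-- The partial derivative in the second variable. -/
noncomputable def d2 (f : ℝ × ℝ → E) (z : ℝ × ℝ) : E := fderiv ℝ f z (0, 1)

theorem contDiff_d1 {f : ℝ × ℝ → E} {m n : WithTop ℕ∞} (hf : ContDiff ℝ n f) (h : m + 1 ≤ n) :
    ContDiff ℝ m (d1 f) := (hf.fderiv_right h).clm_apply contDiff_const

theorem contDiff_d2 {f : ℝ × ℝ → E} {m n : WithTop ℕ∞} (hf : ContDiff ℝ n f) (h : m + 1 ≤ n) :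
    ContDiff ℝ m (d2 f) := (hf.fderiv_right h).clm_apply contDiff_const

theorem hasDerivAt_curve {f : ℝ × ℝ → E} {a b : ℝ → ℝ} {a' b' x : ℝ}
    (hf : DifferentiableAt ℝ f (a x, b x)) (ha : HasDerivAt a a' x) (hb : HasDerivAt b b' x) :
    HasDerivAt (fun x => f (a x, b x)) (a' • d1 f (a x, b x) + b' • d2 f (a x, b x)) x := by
  have h := hf.hasFDerivAt.comp_hasDerivAt x (ha.prodMk hb)
  convert! h using 1
  rw [d1, d2, ← map_smul, ← map_smul, ← map_add]
  simp

theorem hasDerivAt_fst {f : ℝ × ℝ → E} {u θ : ℝ} (hf : DifferentiableAt ℝ f (u, θ)) :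
    HasDerivAt (fun x => f (x, θ)) (d1 f (u, θ)) u := by
  simpa using hasDerivAt_curve (a := fun x => x) (b := fun _ => θ) hf (hasDerivAt_id' u)
    (hasDerivAt_const u θ)

theorem hasDerivAt_snd {f : ℝ × ℝ → E} {u θ : ℝ} (hf : DifferentiableAt ℝ f (u, θ)) :
    HasDerivAt (fun x => f (u, x)) (d2 f (u, θ)) θ := by
  simpa using hasDerivAt_curve (a := fun _ => u) (b := fun x => x) hf (hasDerivAt_const θ u)
    (hasDerivAt_id' θ)

theorem d1_d2_comm {f : ℝ × ℝ → E} (hf : ContDiff ℝ 2 f) (z : ℝ × ℝ) :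
    d1 (d2 f) z = d2 (d1 f) z := by
  have hd : DifferentiableAt ℝ (fderiv ℝ f) z :=
    (hf.fderiv_right (m := 1) (by norm_num)).differentiable one_ne_zero z
  have hs : IsSymmSndFDerivAt ℝ f z := hf.contDiffAt.isSymmSndFDerivAt (by simp)
  have key : ∀ v w : ℝ × ℝ, fderiv ℝ (fun z => fderiv ℝ f z v) z w = fderiv ℝ (fderiv ℝ f) z w v := by
    intro v w
    have := hd.hasFDerivAt.clm_apply (hasFDerivAt_const v z)
    rw [this.fderiv]
    simp
  change fderiv ℝ (fun z => fderiv ℝ f z (0, 1)) z (1, 0) =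
    fderiv ℝ (fun z => fderiv ℝ f z (1, 0)) z (0, 1)
  rw [key, key, hs]

end partials

/-! ### Lagrangian parametrization of the moving curve -/

theorem HasDerivAt.coord {f : ℝ → Plane} {f' : Plane} {x : ℝ} (h : HasDerivAt f f' x) (i : Fin 2) :
    HasDerivAt (fun x => f x i) (f' i) x :=
  (EuclideanSpace.proj (𝕜 := ℝ) i).hasFDerivAt.comp_hasDerivAt x h

/-- `F` is a smooth global parametrization, by a Lagrangian parameter of period `1`, of the moving
curve at the times `θ ≥ 0`. -/
structure IsMotion (G : Set Plane) (Φ : Plane → ℝ → Plane) (F : ℝ × ℝ → Plane) : Prop where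
  contDiff : ContDiff ℝ 3 F
  periodic : ∀ θ, 0 ≤ θ → ∀ u, F (u + 1, θ) = F (u, θ)
  eq_add_int : ∀ θ, 0 ≤ θ → ∀ u u', F (u, θ) = F (u', θ) → ∃ k : ℤ, u' = u + k
  regular : ∀ θ, 0 ≤ θ → ∀ u, d1 F (u, θ) ≠ 0
  range_eq : ∀ θ, 0 ≤ θ → range (fun u => F (u, θ)) = config G Φ θ
  location_eq : ∀ t, 0 ≤ t → ∀ θ, 0 ≤ θ → ∀ u, location G Φ t (F (u, t)) θ = F (u, θ)

theorem IsConfiguration.exists_isMotion {G O : Set Plane} {Φ : Plane → ℝ → Plane}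
    (h : IsConfiguration G O Φ) : ∃ F, IsMotion G Φ F := by
  obtain ⟨γ, hγ, hper, hreg, hinj, hrange⟩ := h.jordan
  have hO : ∀ u, γ u ∈ O := fun u => h.subset (hrange ▸ mem_range_self u)
  have hf : ContDiffOn ℝ 3 (fun z : ℝ × ℝ => Φ (γ z.1) z.2) {z : ℝ × ℝ | 0 ≤ z.2} := by
    have h1 : ContDiff ℝ 3 fun z : ℝ × ℝ => (γ z.1, z.2) :=
      (hγ.comp contDiff_fst).prodMk contDiff_snd
    exact h.contDiffOn.comp h1.contDiffOn fun z hz => ⟨hO _, hz⟩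
  obtain ⟨F, hF, hFeq⟩ := exists_contDiff_extension hf
  have hFeq : ∀ θ, 0 ≤ θ → ∀ u, F (u, θ) = Φ (γ u) θ := fun θ hθ u => hFeq (u, θ) hθ
  have hinjγ : ∀ u u', γ u = γ u' → ∃ k : ℤ, u' = u + k := by
    intro u u' huu
    have hfr : ∀ u, γ u = γ (Int.fract u) := fun u => by
      simpa only [mul_one, Int.self_sub_floor] using (hper.sub_int_mul_eq (x := u) ⌊u⌋).symm
    have := hinj ⟨Int.fract_nonneg u', Int.fract_lt_one u'⟩
      ⟨Int.fract_nonneg u, Int.fract_lt_one u⟩ (by rw [← hfr, ← hfr, huu])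
    obtain ⟨k, hk⟩ := Int.fract_eq_fract.1 this
    exact ⟨k, by linarith⟩
  refine ⟨F, hF, ?_, ?_, ?_, ?_, ?_⟩
  · intro θ hθ u
    rw [hFeq θ hθ, hFeq θ hθ, hper u]
  · intro θ hθ u u' huu
    rw [hFeq θ hθ, hFeq θ hθ] at huu
    exact hinjγ u u' (h.injOn θ hθ (hO u) (hO u') huu)
  · intro θ hθ u
    have hinv := h.invertible θ hθ (γ u) (hO u)
    have hd : DifferentiableAt ℝ (fun x => Φ x θ) (γ u) := by
      -- Where differentiability fails `fderiv` is `0`, which kills `deriv γ u ≠ 0` and so is not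
      -- invertible.
      by_contra hd
      rw [fderiv_zero_of_not_differentiableAt hd] at hinv
      obtain ⟨e, he⟩ := hinv
      have h1 : e (deriv γ u) = 0 := by
        rw [← ContinuousLinearEquiv.coe_coe, he]; rfl
      exact hreg u (e.map_eq_zero_iff.1 h1)
    have h1 : HasDerivAt (fun x => F (x, θ)) (fderiv ℝ (fun x => Φ x θ) (γ u) (deriv γ u)) u := by
      have := hd.hasFDerivAt.comp_hasDerivAt u (hγ.differentiable (by norm_num) u).hasDerivAt
      exact this.congr_of_eventuallyEq (.of_forall fun x => hFeq θ hθ x)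
    rw [(hasDerivAt_fst (hF.differentiable (by norm_num) (u, θ))).unique h1]
    obtain ⟨e, he⟩ := hinv
    rw [← he]
    exact fun h0 => hreg u (e.map_eq_zero_iff.1 h0)
  · intro θ hθ
    simp only [hFeq θ hθ, config, ← hrange]
    exact (range_comp (fun q => Φ q θ) γ)
  · intro t ht θ hθ u
    have hmem : γ u ∈ G := hrange ▸ mem_range_self u
    have hex : ∃ q ∈ G, (fun q => Φ q t) q = F (u, t) := ⟨γ u, hmem, (hFeq t ht u).symm⟩
    have h1 := Function.invFunOn_mem hex
    have h2 := Function.invFunOn_eq hex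
    have h3 : seed G Φ t (F (u, t)) = γ u :=
      h.injOn t ht (h.subset h1) (hO u) (h2.trans (hFeq t ht u))
    rw [location, h3, hFeq θ hθ]

theorem IsMotion.flip {G : Set Plane} {Φ : Plane → ℝ → Plane} {F : ℝ × ℝ → Plane}
    (h : IsMotion G Φ F) : IsMotion G Φ (fun z => F (-z.1, z.2)) where
  contDiff := h.contDiff.comp (contDiff_fst.neg.prodMk contDiff_snd)
  periodic θ hθ u := by
    have := h.periodic θ hθ (-(u + 1))
    simpa using this.symm
  eq_add_int θ hθ u u' huu := by
    obtain ⟨k, hk⟩ := h.eq_add_int θ hθ _ _ huu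
    exact ⟨-k, by push_cast; linarith⟩
  regular θ hθ u := by
    have hd := h.contDiff.differentiable (by norm_num)
    have h1 := hasDerivAt_curve (a := fun x => -x) (b := fun _ => θ) (x := u)
      (hd _) (hasDerivAt_neg u) (hasDerivAt_const u θ)
    have h2 := hasDerivAt_fst (f := fun z : ℝ × ℝ => F (-z.1, z.2)) (u := u) (θ := θ)
      ((hd.comp (by fun_prop : Differentiable ℝ fun z : ℝ × ℝ => (-z.1, z.2))) _)
    rw [h2.unique h1]
    simpa using h.regular θ hθ (-u)
  range_eq θ hθ := by
    rw [← h.range_eq θ hθ]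
    exact (Equiv.neg ℝ).surjective.range_comp (fun u => F (u, θ))
  location_eq t ht θ hθ u := h.location_eq t ht θ hθ (-u)

/-! ### Orientation -/

/-- At a rightmost point the tangent is vertical. If it pointed down, the left normal would point
right, and the horizontal ray to the right, which avoids the curve, would lie in the bounded
component reached along that normal. -/
theorem IsNaturalParam.tangent_of_rightmost {Γ : Set Plane} {c : ℝ → Plane}
    (hc : IsNaturalParam Γ c) {s : ℝ} (hmax : ∀ q ∈ Γ, q 0 ≤ c s 0) : 0 < deriv c s 1 := by
  have hd := (hc.contDiff.differentiable one_ne_zero s).hasDerivAt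
  have h0 : deriv c s 0 = 0 := by
    have hm : IsLocalMax (fun x => c x 0) s :=
      .of_forall fun x => hmax _ (hc.range_eq ▸ mem_range_self x)
    rw [← (HasDerivAt.coord hd 0).deriv]
    exact hm.deriv_eq_zero
  have h1 : (deriv c s 1) ^ 2 = 1 := by
    have := hc.unit_speed s
    rw [EuclideanSpace.norm_eq, Real.sqrt_eq_one] at this
    simpa [Fin.sum_univ_two, h0] using this
  rcases sq_eq_sq_iff_eq_or_eq_neg.1 (h1.trans (one_pow 2).symm) with h | h
  · rw [h]; exact one_pos
  exfalso
  have hrot : rot (deriv c s) = EuclideanSpace.single 0 1 := by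
    ext i
    fin_cases i <;> simp [rot, h, h0]
  obtain ⟨ε, hε, hpos⟩ := ((hc.counterclockwise s).and self_mem_nhdsWithin).exists
  rw [hrot] at hε
  set e : Plane := EuclideanSpace.single 0 1
  have he0 : e 0 = 1 := by simp [e]
  have hray : (fun x : ℝ => c s + x • e) '' Ioi 0 ⊆ connectedComponentIn Γᶜ (c s + ε • e) := by
    refine IsPreconnected.subset_connectedComponentIn ?_ ⟨ε, hpos, rfl⟩ ?_
    · exact isPreconnected_Ioi.image _ (by fun_prop)
    · rintro _ ⟨x, hx, rfl⟩ hmem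
      have := hmax _ hmem
      simp [he0] at this
      exact absurd hx (not_lt.2 this)
  obtain ⟨M, hM⟩ := (hε.2.subset hray).exists_norm_le
  have hM0 : 0 ≤ M := (norm_nonneg _).trans (hM _ ⟨1, mem_Ioi.2 one_pos, rfl⟩)
  have h2 := hM _ ⟨M + 1 + |c s 0|, by simp only [mem_Ioi]; positivity, rfl⟩
  have h3 := (PiLp.norm_apply_le (c s + (M + 1 + |c s 0|) • e) 0).trans h2
  simp only [PiLp.add_apply, PiLp.smul_apply, he0, smul_eq_mul, mul_one, Real.norm_eq_abs] at h3
  have h4 := (le_abs_self _).trans h3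
  linarith [neg_abs_le (c s 0)]

/-- `w` expresses the parameter of `f` through the natural parameter of `c`; the orientations
agree if `ε = 1` and are opposite if `ε = -1`. -/
def IsLift (f c : ℝ → Plane) (ε : ℝ) (w : ℝ → ℝ) : Prop :=
  ∀ s, f (w s) = c s ∧ HasDerivAt w (ε / ‖deriv f (w s)‖) s

theorem IsMotion.deriv_eq {G : Set Plane} {Φ : Plane → ℝ → Plane} {F : ℝ × ℝ → Plane}
    (h : IsMotion G Φ F) (θ u : ℝ) : deriv (fun u => F (u, θ)) u = d1 F (u, θ) :=
  (hasDerivAt_fst (h.contDiff.differentiable (by norm_num) (u, θ))).deriv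

theorem IsMotion.exists_isLift {G : Set Plane} {Φ : Plane → ℝ → Plane} {F : ℝ × ℝ → Plane}
    (h : IsMotion G Φ F) {c : ℝ → Plane} {θ : ℝ} (hθ : 0 ≤ θ)
    (hc : IsNaturalParam (config G Φ θ) c) :
    ∃ ε, (ε = 1 ∨ ε = -1) ∧ ∃ w, IsLift (fun u => F (u, θ)) c ε w := by
  have hF : ContDiff ℝ 1 (fun u => F (u, θ)) :=
    (h.contDiff.of_le (by norm_num)).comp (contDiff_id.prodMk contDiff_const)
  obtain ⟨w, ε, hε, hw⟩ := exists_lift hF (h.periodic θ hθ)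
    (fun u => by rw [h.deriv_eq]; exact h.regular θ hθ u) (h.eq_add_int θ hθ) hc.contDiff
    hc.unit_speed (by rw [hc.range_eq, h.range_eq θ hθ])
  exact ⟨ε, hε, w, hw⟩

theorem IsLift.deriv_eq {f c : ℝ → Plane} {ε : ℝ} {w : ℝ → ℝ} (hw : IsLift f c ε w)
    (hf : Differentiable ℝ f) (s : ℝ) :
    deriv c s = (ε / ‖deriv f (w s)‖) • deriv f (w s) := by
  have h1 := (hf (w s)).hasDerivAt.scomp s (hw s).2
  rw [← h1.deriv]
  congr 1
  exact funext fun x => ((hw x).1).symm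

/-- This reads the orientation sign off `F` alone, without reference to the choice of `c`. -/
theorem IsMotion.sign_of_rightmost {G : Set Plane} {Φ : Plane → ℝ → Plane} {F : ℝ × ℝ → Plane}
    (h : IsMotion G Φ F) {c : ℝ → Plane} {θ : ℝ} (hθ : 0 ≤ θ)
    (hc : IsNaturalParam (config G Φ θ) c) {ε : ℝ} {w : ℝ → ℝ}
    (hw : IsLift (fun u => F (u, θ)) c ε w) {u : ℝ}
    (hu : ∀ v ∈ Icc (0 : ℝ) 1, F (v, θ) 0 ≤ F (u, θ) 0) : 0 < ε * d1 F (u, θ) 1 := by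
  have hmax : ∀ q ∈ config G Φ θ, q 0 ≤ F (u, θ) 0 := by
    intro q hq
    rw [← h.range_eq θ hθ] at hq
    obtain ⟨v, rfl⟩ := hq
    have hp : Function.Periodic (fun u => F (u, θ)) 1 := h.periodic θ hθ
    have := hp.sub_int_mul_eq (x := v) ⌊v⌋
    simp only [mul_one, Int.self_sub_floor] at this
    simp only [← this]
    exact hu _ ⟨Int.fract_nonneg v, (Int.fract_lt_one v).le⟩
  obtain ⟨s, hs⟩ : ∃ s, c s = F (u, θ) := by
    have : F (u, θ) ∈ range c := by
      rw [hc.range_eq, ← h.range_eq θ hθ]; exact mem_range_self u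
    exact this
  have h1 := hc.tangent_of_rightmost (s := s) (by rwa [hs])
  obtain ⟨k, hk⟩ := h.eq_add_int θ hθ u (w s) (hs.symm.trans (hw s).1.symm)
  have h2 : d1 F (w s, θ) = d1 F (u, θ) := by
    rw [← h.deriv_eq, ← h.deriv_eq, hk]
    have hp : Function.Periodic (fun u => F (u, θ)) 1 := h.periodic θ hθ
    have := hp.zsmul k
    have h3 : (fun x => F (x + k, θ)) = fun x => F (x, θ) := by
      funext x; simpa using this x
    rw [← deriv_comp_add_const (f := fun u => F (u, θ)), h3]
  rw [hw.deriv_eq (fun x => (hasDerivAt_fst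
    (h.contDiff.differentiable (by norm_num) (x, θ))).differentiableAt) s, h.deriv_eq, h2] at h1
  have h3 : 0 < ‖d1 F (u, θ)‖ := norm_pos_iff.2 (h.regular θ hθ u)
  simp only [PiLp.smul_apply, smul_eq_mul] at h1
  rw [div_mul_eq_mul_div] at h1
  exact (div_pos_iff_of_pos_right h3).1 h1

/-- The parametrizations `c θ` are unrelated for different `θ`, so constancy of the sign cannot come
from continuity of `c`. Instead the times are sorted by the direction of `d1 F` at a rightmost
point, and `[0, ∞)` is connected. -/
theorem IsMotion.sign_const {G : Set Plane} {Φ : Plane → ℝ → Plane} {F : ℝ × ℝ → Plane}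
    (h : IsMotion G Φ F) {c : ℝ → ℝ → Plane}
    (hc : ∀ θ, 0 ≤ θ → IsNaturalParam (config G Φ θ) (c θ)) :
    ∃ ε : ℝ, (ε = 1 ∨ ε = -1) ∧ ∀ θ, 0 ≤ θ → ∃ w, IsLift (fun u => F (u, θ)) (c θ) ε w := by
  -- The weak inequality makes `A σ` closed, as a projection along a compact interval;
  -- `IsMotion.sign_of_rightmost` rules out equality, so `A 1` and `A (-1)` are disjoint over `[0,
  -- ∞)`.
  let A : ℝ → Set ℝ := fun σ => Prod.snd '' {z : Icc (0 : ℝ) 1 × ℝ |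
    (∀ v ∈ Icc (0 : ℝ) 1, F (v, z.2) 0 ≤ F (z.1, z.2) 0) ∧ 0 ≤ σ * d1 F (z.1, z.2) 1}
  have hFc : Continuous F := h.contDiff.continuous
  have hdc : Continuous (d1 F) := (contDiff_d1 (m := 2) h.contDiff (by norm_num)).continuous
  have hA : ∀ σ, IsClosed (A σ) := by
    intro σ
    refine isClosedMap_snd_of_compactSpace _ (IsClosed.and ?_ ?_)
    · simp only [ofPred_forall]
      refine isClosed_iInter fun v => isClosed_iInter fun _ => isClosed_le ?_ ?_ <;> fun_prop
    · refine isClosed_le ?_ ?_ <;> fun_prop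
  have hmaxex : ∀ θ, ∃ u ∈ Icc (0 : ℝ) 1, ∀ v ∈ Icc (0 : ℝ) 1, F (v, θ) 0 ≤ F (u, θ) 0 := by
    intro θ
    exact isCompact_Icc.exists_isMaxOn (nonempty_Icc.2 zero_le_one)
      (f := fun u => F (u, θ) 0) (by fun_prop)
  have hlift : ∀ σ, (σ = 1 ∨ σ = -1) → ∀ θ, 0 ≤ θ → θ ∈ A σ →
      ∃ w, IsLift (fun u => F (u, θ)) (c θ) σ w := by
    rintro σ hσ θ hθ ⟨⟨u, θ⟩, ⟨hu, hy⟩, rfl⟩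
    obtain ⟨ε, hε, w, hw⟩ := h.exists_isLift hθ (hc _ hθ)
    have := h.sign_of_rightmost hθ (hc _ hθ) hw hu
    suffices σ = ε from this ▸ ⟨w, hw⟩
    simp only at hy this
    rcases hσ with rfl | rfl <;> rcases hε with rfl | rfl <;> first | rfl | (exfalso; linarith)
  have hcover : Ici (0 : ℝ) ⊆ A 1 ∪ A (-1) := by
    intro θ _
    obtain ⟨u, hu, hm⟩ := hmaxex θ
    rcases le_total 0 (d1 F (u, θ) 1) with h0 | h0
    · exact .inl ⟨(⟨u, hu⟩, θ), ⟨hm, by simpa using h0⟩, rfl⟩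
    · exact .inr ⟨(⟨u, hu⟩, θ), ⟨hm, by simpa using h0⟩, rfl⟩
  have hdisj : ¬ (Ici (0 : ℝ) ∩ (A 1 ∩ A (-1))).Nonempty := by
    rintro ⟨θ, hθ, h1, h2⟩
    obtain ⟨w, hw⟩ := hlift 1 (.inl rfl) θ hθ h1
    obtain ⟨w', hw'⟩ := hlift (-1) (.inr rfl) θ hθ h2
    obtain ⟨u, hu, hm⟩ := hmaxex θ
    have := h.sign_of_rightmost hθ (hc _ hθ) hw hm
    have := h.sign_of_rightmost hθ (hc _ hθ) hw' hm
    linarith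
  have hpre := isPreconnected_closed_iff.1 (isPreconnected_Ici (a := (0 : ℝ))) _ _ (hA 1) (hA (-1))
    hcover
  by_cases h1 : (Ici (0 : ℝ) ∩ A 1).Nonempty
  · refine ⟨1, .inl rfl, fun θ hθ => hlift 1 (.inl rfl) θ hθ ?_⟩
    by_contra hn
    exact hdisj (hpre h1 ⟨θ, hθ, (hcover hθ).resolve_left hn⟩)
  · refine ⟨-1, .inr rfl, fun θ hθ => hlift (-1) (.inr rfl) θ hθ ?_⟩
    exact (hcover hθ).resolve_left fun hn => h1 ⟨θ, hθ, hn⟩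

theorem IsConfiguration.exists_motion_lift {G O : Set Plane} {Φ : Plane → ℝ → Plane}
    (h : IsConfiguration G O Φ) {c : ℝ → ℝ → Plane}
    (hc : ∀ θ, 0 ≤ θ → IsNaturalParam (config G Φ θ) (c θ)) :
    ∃ F, IsMotion G Φ F ∧ ∀ θ, 0 ≤ θ → ∃ w, IsLift (fun u => F (u, θ)) (c θ) 1 w := by
  obtain ⟨F, hF⟩ := h.exists_isMotion
  obtain ⟨ε, rfl | rfl, hw⟩ := hF.sign_const hc
  · exact ⟨F, hF, hw⟩
  · refine ⟨_, hF.flip, fun θ hθ => ?_⟩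
    obtain ⟨w, hw⟩ := hw θ hθ
    refine ⟨fun s => -w s, fun s => ⟨by simpa using (hw s).1, ?_⟩⟩
    have h1 : deriv (fun u => F (-u, θ)) (-w s) = -deriv (fun u => F (u, θ)) (w s) := by
      rw [deriv_comp_neg (f := fun u => F (u, θ)), neg_neg]
    simp only [h1, norm_neg]
    convert! (hw s).2.neg using 1
    ring

/-! ### Geometric quantities in Lagrangian form -/

theorem HasDerivAt.plane {a b : ℝ → ℝ} {a' b' x : ℝ} (ha : HasDerivAt a a' x)
    (hb : HasDerivAt b b' x) : HasDerivAt (fun x => (!₂[a x, b x] : Plane)) !₂[a', b'] x := by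
  have key : ∀ α β : ℝ, (!₂[α, β] : Plane) =
      α • EuclideanSpace.single 0 1 + β • EuclideanSpace.single 1 1 := by
    intro α β
    ext i
    fin_cases i <;> simp
  simp only [key]
  exact (ha.smul_const _).add (hb.smul_const _)

theorem HasDerivAt.sqrt_sq_add_sq {P Q : ℝ → ℝ} {P' Q' x : ℝ} (hP : HasDerivAt P P' x)
    (hQ : HasDerivAt Q Q' x) (h : √(P x ^ 2 + Q x ^ 2) ≠ 0) :
    HasDerivAt (fun x => √(P x ^ 2 + Q x ^ 2)) ((P x * P' + Q x * Q') / √(P x ^ 2 + Q x ^ 2)) x := by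
  have h0 : P x ^ 2 + Q x ^ 2 ≠ 0 := fun h0 => h (by rw [h0, Real.sqrt_zero])
  convert! ((hP.fun_pow 2).fun_add (hQ.fun_pow 2)).sqrt h0 using 1
  field_simp
  ring

theorem inner_plane (v w : Plane) : inner ℝ v w = v 0 * w 0 + v 1 * w 1 := by
  simp [PiLp.inner_apply, Fin.sum_univ_two, mul_comm]

theorem norm_plane (v : Plane) : ‖v‖ = √(v 0 ^ 2 + v 1 ^ 2) := by
  simp [EuclideanSpace.norm_eq, Fin.sum_univ_two]

/-- The coordinate `i` of the parametrization. -/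
def coord (F : ℝ × ℝ → Plane) (i : Fin 2) (z : ℝ × ℝ) : ℝ := F z i

theorem contDiff_coord {F : ℝ × ℝ → Plane} {n : WithTop ℕ∞} (hF : ContDiff ℝ n F) (i : Fin 2) :
    ContDiff ℝ n (coord F i) := (EuclideanSpace.proj (𝕜 := ℝ) i).contDiff.comp hF

theorem fderiv_coord {F : ℝ × ℝ → Plane} {z : ℝ × ℝ} (hF : DifferentiableAt ℝ F z) (i : Fin 2)
    (v : ℝ × ℝ) : fderiv ℝ (coord F i) z v = fderiv ℝ F z v i := by
  have := (EuclideanSpace.proj (𝕜 := ℝ) i).hasFDerivAt.comp z hF.hasFDerivAt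
  have h2 : fderiv ℝ (coord F i) z = _ := this.fderiv
  rw [h2]
  rfl

/-- The speed with which the curve is run. -/
noncomputable def speed (F : ℝ × ℝ → Plane) (z : ℝ × ℝ) : ℝ :=
  √(d1 (coord F 0) z ^ 2 + d1 (coord F 1) z ^ 2)

/-- The curvature as a function of the Lagrangian parameter and time. -/
noncomputable def lagCurvature (F : ℝ × ℝ → Plane) (z : ℝ × ℝ) : ℝ :=
  (d1 (coord F 0) z * d1 (d1 (coord F 1)) z - d1 (coord F 1) z * d1 (d1 (coord F 0)) z) /
    speed F z ^ 3

/-- The tangential velocity as a function of the Lagrangian parameter and time. -/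
noncomputable def lagTangentialVelocity (F : ℝ × ℝ → Plane) (z : ℝ × ℝ) : ℝ :=
  (d2 (coord F 0) z * d1 (coord F 0) z + d2 (coord F 1) z * d1 (coord F 1) z) / speed F z

/-- The normal velocity as a function of the Lagrangian parameter and time. -/
noncomputable def lagNormalVelocity (F : ℝ × ℝ → Plane) (z : ℝ × ℝ) : ℝ :=
  (d2 (coord F 1) z * d1 (coord F 0) z - d2 (coord F 0) z * d1 (coord F 1) z) / speed F z

/-- The angular velocity as a function of the Lagrangian parameter and time. -/
noncomputable def lagAngularVelocity (F : ℝ × ℝ → Plane) (z : ℝ × ℝ) : ℝ :=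
  (d1 (coord F 0) z * d2 (d1 (coord F 1)) z - d1 (coord F 1) z * d2 (d1 (coord F 0)) z) /
    speed F z ^ 2 - lagCurvature F z * lagTangentialVelocity F z

/-- The unit tangent vector as a function of the Lagrangian parameter and time. -/
noncomputable def unitTangent (F : ℝ × ℝ → Plane) (z : ℝ × ℝ) : Plane :=
  !₂[d1 (coord F 0) z / speed F z, d1 (coord F 1) z / speed F z]

/-- The unit normal vector as a function of the Lagrangian parameter and time. -/
noncomputable def unitNormal (F : ℝ × ℝ → Plane) (z : ℝ × ℝ) : Plane :=
  !₂[-(d1 (coord F 1) z / speed F z), d1 (coord F 0) z / speed F z]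

/-- A smooth parametrization of the moving curve that agrees with the orientation of the natural
parametrizations `c θ`. -/
structure IsOrientedMotion (G : Set Plane) (Φ : Plane → ℝ → Plane) (c : ℝ → ℝ → Plane)
    (F : ℝ × ℝ → Plane) : Prop extends IsMotion G Φ F where
  natural : ∀ θ, 0 ≤ θ → IsNaturalParam (config G Φ θ) (c θ)
  exists_lift : ∀ θ, 0 ≤ θ → ∃ w, IsLift (fun u => F (u, θ)) (c θ) 1 w

section

variable {G : Set Plane} {Φ : Plane → ℝ → Plane} {F : ℝ × ℝ → Plane}

theorem IsMotion.differentiable (h : IsMotion G Φ F) : Differentiable ℝ F :=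
  h.contDiff.differentiable (by norm_num)

theorem IsMotion.coord_contDiff (h : IsMotion G Φ F) (i : Fin 2) : ContDiff ℝ 3 (coord F i) :=
  contDiff_coord h.contDiff i

theorem IsMotion.coord_differentiable (h : IsMotion G Φ F) (i : Fin 2) :
    Differentiable ℝ (coord F i) := (h.coord_contDiff i).differentiable (by norm_num)

theorem IsMotion.d1_contDiff (h : IsMotion G Φ F) (i : Fin 2) : ContDiff ℝ 2 (d1 (coord F i)) :=
  contDiff_d1 (h.coord_contDiff i) (by norm_num)

theorem IsMotion.d2_contDiff (h : IsMotion G Φ F) (i : Fin 2) : ContDiff ℝ 2 (d2 (coord F i)) :=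
  contDiff_d2 (h.coord_contDiff i) (by norm_num)

theorem IsMotion.d1_differentiable (h : IsMotion G Φ F) (i : Fin 2) :
    Differentiable ℝ (d1 (coord F i)) := (h.d1_contDiff i).differentiable (by norm_num)

theorem IsMotion.d2_differentiable (h : IsMotion G Φ F) (i : Fin 2) :
    Differentiable ℝ (d2 (coord F i)) := (h.d2_contDiff i).differentiable (by norm_num)

theorem IsMotion.d1_d1_differentiable (h : IsMotion G Φ F) (i : Fin 2) :
    Differentiable ℝ (d1 (d1 (coord F i))) :=
  (contDiff_d1 (m := 1) (h.d1_contDiff i) (by norm_num)).differentiable one_ne_zero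

theorem IsMotion.d2_d1_differentiable (h : IsMotion G Φ F) (i : Fin 2) :
    Differentiable ℝ (d2 (d1 (coord F i))) :=
  (contDiff_d2 (m := 1) (h.d1_contDiff i) (by norm_num)).differentiable one_ne_zero

theorem IsMotion.d1_d2_coord (h : IsMotion G Φ F) (i : Fin 2) (z : ℝ × ℝ) :
    d1 (d2 (coord F i)) z = d2 (d1 (coord F i)) z :=
  d1_d2_comm ((h.coord_contDiff i).of_le (by norm_num)) z

theorem IsMotion.d1_apply (h : IsMotion G Φ F) (z : ℝ × ℝ) (i : Fin 2) :
    d1 F z i = d1 (coord F i) z := (fderiv_coord (h.differentiable z) i _).symm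

theorem IsMotion.d2_apply (h : IsMotion G Φ F) (z : ℝ × ℝ) (i : Fin 2) :
    d2 F z i = d2 (coord F i) z := (fderiv_coord (h.differentiable z) i _).symm

theorem IsMotion.norm_d1 (h : IsMotion G Φ F) (z : ℝ × ℝ) : ‖d1 F z‖ = speed F z := by
  rw [norm_plane, h.d1_apply, h.d1_apply, speed]

theorem IsMotion.speed_pos (h : IsMotion G Φ F) {θ : ℝ} (hθ : 0 ≤ θ) (u : ℝ) :
    0 < speed F (u, θ) := by
  rw [← h.norm_d1]; exact norm_pos_iff.2 (h.regular θ hθ u)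

theorem speed_sq (F : ℝ × ℝ → Plane) (z : ℝ × ℝ) :
    speed F z ^ 2 = d1 (coord F 0) z ^ 2 + d1 (coord F 1) z ^ 2 :=
  Real.sq_sqrt (by positivity)

theorem IsMotion.periodic_int (h : IsMotion G Φ F) {θ : ℝ} (hθ : 0 ≤ θ) (u : ℝ) (k : ℤ) :
    F (u + k, θ) = F (u, θ) := by
  have hp : Function.Periodic (fun u => F (u, θ)) 1 := h.periodic θ hθ
  simpa using (hp.zsmul k) u

theorem IsMotion.d1_periodic_int (h : IsMotion G Φ F) {θ : ℝ} (hθ : 0 ≤ θ) (u : ℝ) (k : ℤ) :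
    d1 F (u + k, θ) = d1 F (u, θ) := by
  rw [← h.deriv_eq, ← h.deriv_eq, ← deriv_comp_add_const (f := fun u => F (u, θ))]
  congr 1
  exact funext fun x => h.periodic_int hθ x k

variable {c : ℝ → ℝ → Plane}

/-- `param` picks one of many natural parameters of the point; an integer shift of the lift makes it
take the value `u` exactly there. -/
theorem IsOrientedMotion.exists_lift_at (h : IsOrientedMotion G Φ c F) {θ : ℝ} (hθ : 0 ≤ θ)
    (u : ℝ) : ∃ w, IsLift (fun u => F (u, θ)) (c θ) 1 w ∧ w (param (c θ) (F (u, θ))) = u := by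
  obtain ⟨w, hw⟩ := h.exists_lift θ hθ
  have hmem : ∃ s, c θ s = F (u, θ) := by
    have : F (u, θ) ∈ range (c θ) := by
      rw [(h.natural θ hθ).range_eq, ← h.range_eq θ hθ]; exact mem_range_self u
    exact this
  have hs : c θ (param (c θ) (F (u, θ))) = F (u, θ) := Function.invFun_eq hmem
  obtain ⟨k, hk⟩ := h.eq_add_int θ hθ u _ (hs.symm.trans (hw _).1.symm)
  refine ⟨fun s => w s - k, fun s => ⟨?_, ?_⟩, by simp [hk]⟩
  · rw [← (hw s).1]
    have := h.periodic_int hθ (w s - k) k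
    simpa using this.symm
  · have h1 : deriv (fun u => F (u, θ)) (w s - k) = deriv (fun u => F (u, θ)) (w s) := by
      rw [h.deriv_eq, h.deriv_eq, ← h.d1_periodic_int hθ (w s - k) k, sub_add_cancel]
    simp only [h1]
    exact (hw s).2.sub_const _

/-- The chain rule along the lift, whose derivative is `1 / speed`. Every arc derivative below is
computed through this. -/
theorem IsOrientedMotion.hasDerivAt_arc (h : IsOrientedMotion G Φ c F) {θ : ℝ} (hθ : 0 ≤ θ)
    {u : ℝ} {E : Type*} [NormedAddCommGroup E] [NormedSpace ℝ E] {f : Plane → E} {D : E}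
    (hf : HasDerivAt (fun x => f (F (x, θ))) D u) :
    HasDerivAt (fun s => f (c θ s)) ((speed F (u, θ))⁻¹ • D) (param (c θ) (F (u, θ))) := by
  obtain ⟨w, hw, hwu⟩ := h.exists_lift_at hθ u
  have h1 := (hw (param (c θ) (F (u, θ)))).2
  rw [h.deriv_eq, h.norm_d1, hwu, one_div] at h1
  rw [← hwu] at hf
  have h2 := hf.scomp _ h1
  exact h2.congr_of_eventuallyEq (.of_forall fun s => congrArg f ((hw s).1).symm)

theorem IsOrientedMotion.tangent_eq (h : IsOrientedMotion G Φ c F) {θ : ℝ} (hθ : 0 ≤ θ) (u : ℝ) :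
    tangent (c θ) (F (u, θ)) = unitTangent F (u, θ) := by
  have h1 := h.hasDerivAt_arc hθ (f := id) (u := u) (hasDerivAt_fst (h.differentiable _))
  rw [tangent, unitTangent]
  refine h1.deriv.trans ?_
  ext i
  fin_cases i <;> simp [h.d1_apply, div_eq_inv_mul]

theorem IsOrientedMotion.normal_eq (h : IsOrientedMotion G Φ c F) {θ : ℝ} (hθ : 0 ≤ θ) (u : ℝ) :
    normal (c θ) (F (u, θ)) = unitNormal F (u, θ) := by
  rw [normal, h.tangent_eq hθ, rot, unitNormal, unitTangent]
  simp

theorem IsMotion.hasDerivAt_speed (h : IsMotion G Φ F) {a b : ℝ → ℝ} {a' b' x : ℝ}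
    (ha : HasDerivAt a a' x) (hb : HasDerivAt b b' x) (hm : speed F (a x, b x) ≠ 0) :
    HasDerivAt (fun x => speed F (a x, b x))
      ((d1 (coord F 0) (a x, b x) *
          (a' * d1 (d1 (coord F 0)) (a x, b x) + b' * d2 (d1 (coord F 0)) (a x, b x)) +
        d1 (coord F 1) (a x, b x) *
          (a' * d1 (d1 (coord F 1)) (a x, b x) + b' * d2 (d1 (coord F 1)) (a x, b x))) /
        speed F (a x, b x)) x :=
  HasDerivAt.sqrt_sq_add_sq (hasDerivAt_curve (h.d1_differentiable 0 _) ha hb)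
    (hasDerivAt_curve (h.d1_differentiable 1 _) ha hb) hm

/-- A unit vector can only turn, so its derivative is normal. The path in `(u, θ)` is arbitrary: a
fixed time gives the curvature, the path of the projection gives the angular velocity. -/
theorem IsMotion.hasDerivAt_unitTangent (h : IsMotion G Φ F) {a b : ℝ → ℝ} {a' b' x : ℝ}
    (ha : HasDerivAt a a' x) (hb : HasDerivAt b b' x) (hm : speed F (a x, b x) ≠ 0) :
    HasDerivAt (fun x => unitTangent F (a x, b x))
      (((d1 (coord F 0) (a x, b x) *
          (a' * d1 (d1 (coord F 1)) (a x, b x) + b' * d2 (d1 (coord F 1)) (a x, b x)) -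
        d1 (coord F 1) (a x, b x) *
          (a' * d1 (d1 (coord F 0)) (a x, b x) + b' * d2 (d1 (coord F 0)) (a x, b x))) /
        speed F (a x, b x) ^ 2) • unitNormal F (a x, b x)) x := by
  have hP := hasDerivAt_curve (h.d1_differentiable 0 _) ha hb
  have hQ := hasDerivAt_curve (h.d1_differentiable 1 _) ha hb
  have hM := h.hasDerivAt_speed ha hb hm
  have hsq := speed_sq F (a x, b x)
  convert! HasDerivAt.plane (hP.div hM hm) (hQ.div hM hm) using 1
  simp only [smul_eq_mul]
  ext i
  fin_cases i
  · simp [unitNormal]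
    field_simp
    rw [hsq]
    ring
  · simp [unitNormal]
    field_simp
    rw [hsq]
    ring

theorem inner_unitNormal_self {z : ℝ × ℝ} (hm : speed F z ≠ 0) :
    inner ℝ (unitNormal F z) (unitNormal F z) = (1 : ℝ) := by
  have hsq := speed_sq F z
  simp only [inner_plane, unitNormal]
  simp
  field_simp
  rw [hsq]
  ring

theorem IsOrientedMotion.curvature_eq (h : IsOrientedMotion G Φ c F) {θ : ℝ} (hθ : 0 ≤ θ) (u : ℝ) :
    curvature (c θ) (F (u, θ)) = lagCurvature F (u, θ) := by
  have hm := (h.speed_pos hθ u).ne'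
  have h1 := h.hasDerivAt_unitTangent (hasDerivAt_id' u) (hasDerivAt_const u θ) hm
  have h2 := h.hasDerivAt_arc hθ (f := tangent (c θ)) (u := u)
    (h1.congr_of_eventuallyEq (.of_forall fun x => h.tangent_eq hθ x))
  rw [curvature, arcDeriv, h2.deriv, h.normal_eq hθ, real_inner_smul_left, real_inner_smul_left,
    inner_unitNormal_self hm, lagCurvature]
  field_simp
  ring

theorem IsMotion.velocity_eq (h : IsMotion G Φ F) {θ : ℝ} (hθ : 0 ≤ θ) (u : ℝ) :
    velocity G Φ θ (F (u, θ)) = d2 F (u, θ) := by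
  have h1 := (hasDerivAt_snd (h.differentiable (u, θ))).hasDerivWithinAt (s := Ici 0)
  have h2 := h1.congr (fun x hx => h.location_eq θ hθ x hx u) (h.location_eq θ hθ θ hθ u)
  exact h2.derivWithin (uniqueDiffOn_Ici 0 θ hθ)

theorem IsMotion.acceleration_eq (h : IsMotion G Φ F) {θ : ℝ} (hθ : 0 ≤ θ) (u : ℝ) :
    acceleration G Φ θ (F (u, θ)) = d2 (d2 F) (u, θ) := by
  have hd : Differentiable ℝ (d2 F) :=
    (contDiff_d2 (m := 2) h.contDiff (by norm_num)).differentiable (by norm_num)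
  have hv : EqOn (derivWithin (location G Φ θ (F (u, θ))) (Ici 0)) (fun x => d2 F (u, x))
      (Ici 0) := by
    intro x hx
    have h1 := (hasDerivAt_snd (h.differentiable (u, x))).hasDerivWithinAt (s := Ici 0)
    have h2 := h1.congr (fun y hy => h.location_eq θ hθ y hy u) (h.location_eq θ hθ x hx u)
    exact h2.derivWithin (uniqueDiffOn_Ici 0 x hx)
  rw [acceleration, iteratedDerivWithin_succ, iteratedDerivWithin_one,
    derivWithin_congr hv (hv hθ)]
  exact (hasDerivAt_snd (hd (u, θ))).hasDerivWithinAt.derivWithin (uniqueDiffOn_Ici 0 θ hθ)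

theorem IsMotion.d2_d2_apply (h : IsMotion G Φ F) (z : ℝ × ℝ) (i : Fin 2) :
    d2 (d2 F) z i = d2 (d2 (coord F i)) z := by
  have hd : Differentiable ℝ (d2 F) :=
    (contDiff_d2 (m := 2) h.contDiff (by norm_num)).differentiable (by norm_num)
  have h1 : coord (d2 F) i = d2 (coord F i) := funext fun z => h.d2_apply z i
  rw [← h1]
  exact (fderiv_coord (hd z) i _).symm

theorem IsMotion.d2_d1_apply (h : IsMotion G Φ F) (z : ℝ × ℝ) (i : Fin 2) :
    d1 (d2 F) z i = d2 (d1 (coord F i)) z := by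
  have hd : Differentiable ℝ (d2 F) :=
    (contDiff_d2 (m := 2) h.contDiff (by norm_num)).differentiable (by norm_num)
  have h1 : coord (d2 F) i = d2 (coord F i) := funext fun z => h.d2_apply z i
  rw [← h.d1_d2_coord, ← h1]
  exact (fderiv_coord (hd z) i _).symm

theorem IsOrientedMotion.normalVelocity_eq (h : IsOrientedMotion G Φ c F) {θ : ℝ} (hθ : 0 ≤ θ)
    (u : ℝ) : normalVelocity G Φ c θ (F (u, θ)) = lagNormalVelocity F (u, θ) := by
  rw [normalVelocity, h.velocity_eq hθ, h.normal_eq hθ, inner_plane, unitNormal,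
    lagNormalVelocity, h.d2_apply, h.d2_apply]
  simp
  ring

theorem IsOrientedMotion.tangentialVelocity_eq (h : IsOrientedMotion G Φ c F) {θ : ℝ}
    (hθ : 0 ≤ θ) (u : ℝ) :
    tangentialVelocity G Φ c θ (F (u, θ)) = lagTangentialVelocity F (u, θ) := by
  rw [tangentialVelocity, h.velocity_eq hθ, h.tangent_eq hθ, inner_plane, unitTangent,
    lagTangentialVelocity, h.d2_apply, h.d2_apply]
  simp
  ring

theorem IsOrientedMotion.normalAcceleration_eq (h : IsOrientedMotion G Φ c F) {θ : ℝ}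
    (hθ : 0 ≤ θ) (u : ℝ) : normalAcceleration G Φ c θ (F (u, θ)) =
      (d2 (d2 (coord F 1)) (u, θ) * d1 (coord F 0) (u, θ) -
        d2 (d2 (coord F 0)) (u, θ) * d1 (coord F 1) (u, θ)) / speed F (u, θ) := by
  rw [normalAcceleration, h.acceleration_eq hθ, h.normal_eq hθ, inner_plane, unitNormal,
    h.d2_d2_apply, h.d2_d2_apply]
  simp
  ring

theorem IsOrientedMotion.hasDerivAt_velocity (h : IsOrientedMotion G Φ c F) {θ : ℝ}
    (hθ : 0 ≤ θ) (u : ℝ) : HasDerivAt (fun s => velocity G Φ θ (c θ s))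
      ((speed F (u, θ))⁻¹ • d1 (d2 F) (u, θ)) (param (c θ) (F (u, θ))) := by
  have hd : Differentiable ℝ (d2 F) :=
    (contDiff_d2 (m := 2) h.contDiff (by norm_num)).differentiable (by norm_num)
  exact h.hasDerivAt_arc hθ ((hasDerivAt_fst (hd (u, θ))).congr_of_eventuallyEq
    (.of_forall fun x => h.velocity_eq hθ x))

theorem IsOrientedMotion.inner_tangent_arcDeriv_velocity (h : IsOrientedMotion G Φ c F) {θ : ℝ}
    (hθ : 0 ≤ θ) (u : ℝ) :
    inner ℝ (tangent (c θ) (F (u, θ))) (arcDeriv (c θ) (velocity G Φ θ) (F (u, θ))) =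
      (d1 (coord F 0) (u, θ) * d2 (d1 (coord F 0)) (u, θ) +
        d1 (coord F 1) (u, θ) * d2 (d1 (coord F 1)) (u, θ)) / speed F (u, θ) ^ 2 := by
  have hm := (h.speed_pos hθ u).ne'
  rw [arcDeriv, (h.hasDerivAt_velocity hθ u).deriv, h.tangent_eq hθ, real_inner_smul_right,
    inner_plane, h.d2_d1_apply, h.d2_d1_apply, unitTangent]
  simp
  field_simp

theorem IsOrientedMotion.inner_normal_arcDeriv_velocity (h : IsOrientedMotion G Φ c F) {θ : ℝ}
    (hθ : 0 ≤ θ) (u : ℝ) :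
    inner ℝ (normal (c θ) (F (u, θ))) (arcDeriv (c θ) (velocity G Φ θ) (F (u, θ))) -
      curvature (c θ) (F (u, θ)) * tangentialVelocity G Φ c θ (F (u, θ)) =
      lagAngularVelocity F (u, θ) := by
  have hm := (h.speed_pos hθ u).ne'
  rw [arcDeriv, (h.hasDerivAt_velocity hθ u).deriv, h.normal_eq hθ, real_inner_smul_right,
    inner_plane, h.d2_d1_apply, h.d2_d1_apply, unitNormal, h.curvature_eq hθ,
    h.tangentialVelocity_eq hθ, lagAngularVelocity]
  congr 1
  simp
  field_simp
  ring

end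

/-! ### The nearest-point projection -/

section

variable {G : Set Plane} {Φ : Plane → ℝ → Plane} {F : ℝ × ℝ → Plane}

theorem IsMotion.exists_param_near (h : IsMotion G Φ F) {θ : ℝ} (hθ : 0 ≤ θ) (u₀ : ℝ) {p : Plane}
    (hp : p ∈ config G Φ θ) : ∃ u ∈ Icc (u₀ - 1 / 2) (u₀ + 1 / 2), F (u, θ) = p := by
  rw [← h.range_eq θ hθ] at hp
  obtain ⟨v, rfl⟩ := hp
  have hp : Function.Periodic (fun u => F (u, θ)) 1 := h.periodic θ hθ
  obtain ⟨y, hy, hy'⟩ := hp.exists_mem_Ico one_pos v (u₀ - 1 / 2)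
  exact ⟨y, ⟨hy.1, by linarith [hy.2]⟩, hy'.symm⟩

/-- On the compact set of parameters within half a period of `u₀` but at distance at least `δ` from
it, `F (u, t) ≠ F (u₀, t)` by injectivity modulo `1`; this persists for nearby times and points. -/
theorem IsMotion.eventually_param_near (h : IsMotion G Φ F) {t : ℝ} (ht : 0 ≤ t) (u₀ : ℝ) {δ : ℝ}
    (hδ : 0 < δ) : ∀ᶠ z : ℝ × Plane in 𝓝 (t, F (u₀, t)),
      ∀ u ∈ Icc (u₀ - 1 / 2) (u₀ + 1 / 2), F (u, z.1) = z.2 → |u - u₀| < δ := by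
  have hF := h.contDiff.continuous
  have hK : IsCompact (Icc (u₀ - 1 / 2) (u₀ + 1 / 2) ∩ {u | δ ≤ |u - u₀|}) :=
    isCompact_Icc.inter_right (isClosed_le (by fun_prop) (by fun_prop))
  have key : ∀ u ∈ Icc (u₀ - 1 / 2) (u₀ + 1 / 2) ∩ {u | δ ≤ |u - u₀|},
      ∀ᶠ z : (ℝ × Plane) × ℝ in 𝓝 ((t, F (u₀, t)), u), F (z.2, z.1.1) ≠ z.1.2 := by
    rintro u ⟨hu, hu'⟩
    have hne : F (u, t) ≠ F (u₀, t) := by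
      intro heq
      obtain ⟨k, hk⟩ := h.eq_add_int t ht u₀ u heq.symm
      have h1 : |(k : ℝ)| < 1 := by
        rw [abs_lt]
        constructor <;> linarith [hu.1, hu.2]
      have h2 : k = 0 := by
        have : |k| < 1 := by exact_mod_cast h1
        exact Int.abs_lt_one_iff.1 this
      simp only [hk, h2, Int.cast_zero, add_zero, sub_self, abs_zero, mem_ofPred_eq] at hu'
      linarith
    have c₁ : ContinuousAt (fun z : (ℝ × Plane) × ℝ => F (z.2, z.1.1)) ((t, F (u₀, t)), u) := by
      fun_prop
    have c₂ : ContinuousAt (fun z : (ℝ × Plane) × ℝ => z.1.2) ((t, F (u₀, t)), u) := by fun_prop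
    exact ((c₁.sub c₂).eventually_ne (sub_ne_zero.2 hne)).mono fun z hz => sub_ne_zero.1 hz
  filter_upwards [hK.eventually_forall_of_forall_eventually
    (P := fun (z : ℝ × Plane) u => F (u, z.1) ≠ z.2) key] with z hz u hu heq
  by_contra hlt
  exact hz u ⟨hu, not_lt.1 hlt⟩ heq

/-- The scalar product of the vector from the point `F (x, t)` to the point `F (u, θ)` with the
velocity `d1 F (u, θ)`; it vanishes if `F (u, θ)` is the projection of `F (x, t)`. -/
noncomputable def projEq (F : ℝ × ℝ → Plane) (t : ℝ) (v : (ℝ × ℝ) × ℝ) : ℝ :=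
  (coord F 0 (v.2, v.1.2) - coord F 0 (v.1.1, t)) * d1 (coord F 0) (v.2, v.1.2) +
    (coord F 1 (v.2, v.1.2) - coord F 1 (v.1.1, t)) * d1 (coord F 1) (v.2, v.1.2)

theorem IsMotion.contDiff_projEq (h : IsMotion G Φ F) (t : ℝ) : ContDiff ℝ 1 (projEq F t) := by
  have a : ∀ i, ContDiff ℝ 1 (coord F i) := fun i => (h.coord_contDiff i).of_le (by norm_num)
  have b : ∀ i, ContDiff ℝ 1 (d1 (coord F i)) := fun i => (h.d1_contDiff i).of_le (by norm_num)
  have c₁ : ContDiff ℝ 1 fun v : (ℝ × ℝ) × ℝ => (v.2, v.1.2) := by fun_prop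
  have c₂ : ContDiff ℝ 1 fun v : (ℝ × ℝ) × ℝ => (v.1.1, t) := by fun_prop
  exact ((((a 0).comp c₁).sub ((a 0).comp c₂)).mul ((b 0).comp c₁)).add
    ((((a 1).comp c₁).sub ((a 1).comp c₂)).mul ((b 1).comp c₁))

/-- `2 * projEq` is the derivative of the squared distance, which has a minimum at `u`. -/
theorem IsMotion.projEq_eq_zero (h : IsMotion G Φ F) {t θ x u : ℝ} (hθ : 0 ≤ θ)
    (hu : IsNearest (config G Φ θ) (F (x, t)) (F (u, θ))) : projEq F t ((x, θ), u) = 0 := by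
  let D : ℝ → ℝ := fun v => (coord F 0 (v, θ) - coord F 0 (x, t)) ^ 2 +
    (coord F 1 (v, θ) - coord F 1 (x, t)) ^ 2
  have hD : ∀ v, D v = dist (F (x, t)) (F (v, θ)) ^ 2 := by
    intro v
    rw [dist_eq_norm, norm_plane, Real.sq_sqrt (by positivity)]
    simp only [D, coord, PiLp.sub_apply]
    ring
  have hmin : IsLocalMin D u := .of_forall fun v => by
    rw [hD, hD]
    have hmem : F (v, θ) ∈ config G Φ θ := by
      rw [← h.range_eq θ hθ]; exact mem_range_self v
    exact pow_le_pow_left₀ dist_nonneg (hu.2 _ hmem) 2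
  have hd : HasDerivAt D (2 * projEq F t ((x, θ), u)) u := by
    have h0 := hasDerivAt_fst (h.coord_differentiable 0 (u, θ))
    have h1 := hasDerivAt_fst (h.coord_differentiable 1 (u, θ))
    convert! ((h0.sub_const (coord F 0 (x, t))).fun_pow 2).fun_add
      ((h1.sub_const (coord F 1 (x, t))).fun_pow 2) using 1
    simp only [projEq]
    ring
  have := hd.deriv.symm.trans hmin.deriv_eq_zero
  linarith

/-- `U` gives, near `(u₀, t)`, the Lagrangian parameter of the projection of the point `F (x, t)`
onto the curve at the time `θ`. -/
structure IsProjParam (G : Set Plane) (Φ : Plane → ℝ → Plane) (F : ℝ × ℝ → Plane) (u₀ t : ℝ)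
    (U : ℝ × ℝ → ℝ) : Prop where
  apply_self : U (u₀, t) = u₀
  contDiffAt : ContDiffAt ℝ 1 U (u₀, t)
  projEq_eq : ∀ᶠ z in 𝓝 (u₀, t), projEq F t (z, U z) = 0
  existsUnique : ∀ᶠ z in 𝓝 (u₀, t), 0 ≤ z.2 → ∃! p, IsNearest (config G Φ z.2) (F (z.1, t)) p
  proj_eq : ∀ᶠ z in 𝓝 (u₀, t), 0 ≤ z.2 → proj (config G Φ z.2) (F (z.1, t)) = F (U z, z.2)

theorem IsMotion.isCompact_config (h : IsMotion G Φ F) {θ : ℝ} (hθ : 0 ≤ θ) :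
    IsCompact (config G Φ θ) := by
  have hF := h.contDiff.continuous
  have : config G Φ θ = (fun u => F (u, θ)) '' Icc (0 - 1 / 2) (0 + 1 / 2) := by
    refine Subset.antisymm (fun p hp => ?_) ?_
    · obtain ⟨u, hu, rfl⟩ := h.exists_param_near hθ 0 hp
      exact ⟨u, hu, rfl⟩
    · rw [← h.range_eq θ hθ]
      exact image_subset_range _ _
  rw [this]
  exact isCompact_Icc.image (by fun_prop)

theorem IsMotion.exists_isNearest (h : IsMotion G Φ F) {θ : ℝ} (hθ : 0 ≤ θ) (r : Plane) :
    ∃ p, IsNearest (config G Φ θ) r p := by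
  have hne : (config G Φ θ).Nonempty := by
    rw [← h.range_eq θ hθ]; exact range_nonempty _
  obtain ⟨p, hp, hmin⟩ := (h.isCompact_config hθ).exists_isMinOn hne
    (f := fun q => dist r q) (by fun_prop)
  exact ⟨p, hp, fun q hq => hmin hq⟩

theorem isInvertible_of_apply_one_ne_zero (L : ℝ →L[ℝ] ℝ) (hL : L 1 ≠ 0) : L.IsInvertible := by
  refine ⟨ContinuousLinearEquiv.unitsEquivAut ℝ (Units.mk0 _ hL), ?_⟩
  ext
  simp

/-- The implicit function theorem gives `U`. A nearest point has a parameter close to `u₀` and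
satisfies the equation, so local uniqueness identifies it with `F (U z, z.2)`; existence is
compactness. -/
theorem IsMotion.exists_isProjParam (h : IsMotion G Φ F) {t : ℝ} (ht : 0 ≤ t) (u₀ : ℝ) :
    ∃ U, IsProjParam G Φ F u₀ t U := by
  have hF := h.contDiff.continuous
  have hcd : ContDiffAt ℝ 1 (projEq F t) ((u₀, t), u₀) := (h.contDiff_projEq t).contDiffAt
  have hzero : projEq F t ((u₀, t), u₀) = 0 := by simp [projEq]
  have hinv : (fderiv ℝ (projEq F t) ((u₀, t), u₀) ∘L .inr ℝ (ℝ × ℝ) ℝ).IsInvertible := by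
    apply isInvertible_of_apply_one_ne_zero
    have h1 : HasDerivAt (fun u => projEq F t ((u₀, t), u)) (speed F (u₀, t) ^ 2) u₀ := by
      have a := fun i => hasDerivAt_fst (h.coord_differentiable i (u₀, t))
      have b := fun i => hasDerivAt_fst (h.d1_differentiable i (u₀, t))
      convert! (((a 0).sub_const (coord F 0 (u₀, t))).fun_mul (b 0)).fun_add
        (((a 1).sub_const (coord F 1 (u₀, t))).fun_mul (b 1)) using 1
      rw [speed_sq]
      ring
    have h2 := (hcd.differentiableAt one_ne_zero).hasFDerivAt.comp_hasDerivAt u₀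
      ((hasDerivAt_const u₀ (u₀, t)).prodMk (hasDerivAt_id' u₀))
    have h3 := h2.unique h1
    change fderiv ℝ (projEq F t) ((u₀, t), u₀) (0, 1) ≠ 0
    rw [h3]
    exact pow_ne_zero 2 (h.speed_pos ht u₀).ne'
  set U := hcd.implicitFunction one_ne_zero hinv with hU
  have hself : U (u₀, t) = u₀ := hcd.implicitFunction_apply_self one_ne_zero hinv
  have hsol := hcd.eventually_apply_implicitFunction one_ne_zero hinv
  rw [hzero] at hsol
  have hiff := hcd.eventually_apply_eq_iff_implicitFunction one_ne_zero hinv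
  rw [hzero] at hiff
  obtain ⟨δ, hδ, hball⟩ := Metric.eventually_nhds_iff.1 hiff
  have hnear := h.eventually_param_near ht u₀ hδ
  obtain ⟨η, hη, hnear⟩ := Metric.eventually_nhds_iff.1 hnear
  -- A nearest point is no farther from `F (x, t)` than the particle `F (x, θ)` is, so this sum
  -- bounds its distance from `F (u₀, t)`.
  have e₁ : ∀ᶠ z : ℝ × ℝ in 𝓝 (u₀, t), dist (F (z.1, t)) (F (z.1, z.2)) +
      dist (F (z.1, t)) (F (u₀, t)) < η := by
    have hc : ContinuousAt (fun z : ℝ × ℝ => dist (F (z.1, t)) (F (z.1, z.2)) +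
      dist (F (z.1, t)) (F (u₀, t))) (u₀, t) := by fun_prop
    exact hc.eventually_lt_const (by simpa using hη)
  have e₂ : ∀ᶠ z : ℝ × ℝ in 𝓝 (u₀, t), dist z (u₀, t) < min δ η :=
    Metric.ball_mem_nhds _ (lt_min hδ hη)
  have key : ∀ᶠ z : ℝ × ℝ in 𝓝 (u₀, t), 0 ≤ z.2 →
      ∀ p, IsNearest (config G Φ z.2) (F (z.1, t)) p → p = F (U z, z.2) := by
    filter_upwards [e₁, e₂] with z h₁ h₂ hz p hp
    obtain ⟨u, hu, rfl⟩ := h.exists_param_near hz u₀ hp.1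
    have hd : dist (F (u, z.2)) (F (u₀, t)) < η := by
      have hmem : F (z.1, z.2) ∈ config G Φ z.2 := by
        rw [← h.range_eq z.2 hz]; exact mem_range_self z.1
      have := hp.2 _ hmem
      have := dist_triangle_left (F (u, z.2)) (F (u₀, t)) (F (z.1, t))
      linarith
    have h₃ : dist z.2 t < η :=
      ((le_max_right _ _).trans_lt (h₂.trans_le (min_le_right _ _)) :)
    have h₄ := hnear (y := (z.2, F (u, z.2))) (max_lt h₃ hd) u hu rfl
    have h₅ := (hball (y := (z, u)) (max_lt (h₂.trans_le (min_le_left _ _)) h₄)).1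
      (h.projEq_eq_zero hz hp)
    exact congrArg (fun x => F (x, z.2)) h₅.symm
  refine ⟨U, hself, hcd.contDiffAt_implicitFunction one_ne_zero hinv, hsol, ?_, ?_⟩
  · filter_upwards [key] with z hz h0
    obtain ⟨p, hp⟩ := h.exists_isNearest h0 (F (z.1, t))
    exact ⟨p, hp, fun q hq => (hz h0 q hq).trans (hz h0 p hp).symm⟩
  · filter_upwards [key] with z hz h0
    have hex := h.exists_isNearest h0 (F (z.1, t))
    rw [proj, dif_pos hex]
    exact hz h0 _ hex.choose_spec

/-- Transfers uniqueness from a neighbourhood of the parameter to one of the point on `Γ(t)`. -/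
theorem IsMotion.eventually_existsUnique_isNearest (h : IsMotion G Φ F) {t : ℝ} (ht : 0 ≤ t)
    (u₀ : ℝ) : ∀ᶠ z : Plane × ℝ in 𝓝[config G Φ t] (F (u₀, t)) ×ˢ 𝓝[Ici 0] t,
      ∃! p, IsNearest (config G Φ z.2) z.1 p := by
  obtain ⟨U, hU⟩ := h.exists_isProjParam ht u₀
  obtain ⟨δ, hδ, hball⟩ := Metric.eventually_nhds_iff.1 hU.existsUnique
  have h₁ : ∀ᶠ x in 𝓝[config G Φ t] (F (u₀, t)), ∃ u, |u - u₀| < δ ∧ F (u, t) = x := by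
    have hc : Tendsto (fun x : Plane => (t, x)) (𝓝[config G Φ t] (F (u₀, t)))
        (𝓝 (t, F (u₀, t))) := (Continuous.prodMk_right t).continuousAt.mono_left inf_le_left
    filter_upwards [hc.eventually (h.eventually_param_near ht u₀ hδ), self_mem_nhdsWithin]
      with x hx hmem
    obtain ⟨u, hu, rfl⟩ := h.exists_param_near ht u₀ hmem
    exact ⟨u, hx u hu rfl, rfl⟩
  have h₂ : ∀ᶠ θ in 𝓝[Ici 0] t, dist θ t < δ ∧ 0 ≤ θ :=
    Eventually.and (mem_nhdsWithin_of_mem_nhds (Metric.ball_mem_nhds t hδ)) self_mem_nhdsWithin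
  filter_upwards [h₁.prod_mk h₂] with z hz
  obtain ⟨⟨u, hu, hux⟩, hθ, h0⟩ := hz
  rw [← hux]
  exact hball (y := (u, z.2)) (max_lt hu hθ) h0

/-- The velocity in time of the Lagrangian parameter of the projection. -/
theorem IsMotion.hasDerivAt_projParam (h : IsMotion G Φ F) {t : ℝ} (ht : 0 ≤ t) {u₀ : ℝ}
    {U : ℝ × ℝ → ℝ} (hU : IsProjParam G Φ F u₀ t U) :
    HasDerivAt (fun θ => U (u₀, θ)) (-(lagTangentialVelocity F (u₀, t) / speed F (u₀, t))) t := by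
  have hm := (h.speed_pos ht u₀).ne'
  have hd := hasDerivAt_snd (hU.contDiffAt.differentiableAt one_ne_zero)
  set a := d2 U (u₀, t)
  have hself := hU.apply_self
  have x := fun i => hasDerivAt_curve (a := fun θ => U (u₀, θ)) (b := fun θ => θ)
    (h.coord_differentiable i _) hd (hasDerivAt_id' t)
  have p := fun i => hasDerivAt_curve (a := fun θ => U (u₀, θ)) (b := fun θ => θ)
    (h.d1_differentiable i _) hd (hasDerivAt_id' t)
  have h1 := (((x 0).sub_const (coord F 0 (u₀, t))).fun_mul (p 0)).fun_add
    (((x 1).sub_const (coord F 1 (u₀, t))).fun_mul (p 1))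
  have hc : Tendsto (fun θ : ℝ => (u₀, θ)) (𝓝 t) (𝓝 (u₀, t)) :=
    (Continuous.prodMk_right u₀).continuousAt
  have h2 : HasDerivAt (fun _ : ℝ => (0 : ℝ)) _ t := h1.congr_of_eventuallyEq (by
    filter_upwards [hc.eventually hU.projEq_eq] with θ hθ
    exact hθ.symm)
  have h3 := h2.unique (hasDerivAt_const t 0)
  -- At `θ = t` the displacement vanishes, so only the terms with its derivative survive.
  simp only [hself, sub_self, zero_mul, add_zero, smul_eq_mul, one_mul] at h3
  have hsq := speed_sq F (u₀, t)
  have : a = -(lagTangentialVelocity F (u₀, t) / speed F (u₀, t)) := by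
    rw [lagTangentialVelocity]
    field_simp
    linear_combination h3 + a * hsq
  rwa [← this]

end

/-! ### First-order expansions along the projection -/

theorem isLittleO_of_eventuallyEq {E : Type*} [NormedAddCommGroup E] [NormedSpace ℝ E]
    {f ψ : ℝ → E} {D y : E} {t : ℝ} {s : Set ℝ} (hψ : HasDerivAt ψ D t) (hy : ψ t = y)
    (hf : f =ᶠ[𝓝[s] t] ψ) :
    (fun θ => f θ - (y + (θ - t) • D)) =o[𝓝[s] t] (fun θ => θ - t) := by
  have h1 := (hasDerivAt_iff_isLittleO.1 hψ).mono (nhdsWithin_le_nhds (s := s))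
  refine h1.congr' ?_ EventuallyEq.rfl
  filter_upwards [hf] with θ hθ
  rw [hθ, hy, sub_sub]

section

variable {G : Set Plane} {Φ : Plane → ℝ → Plane} {F : ℝ × ℝ → Plane} {c : ℝ → ℝ → Plane}
  {t u₀ : ℝ} {U : ℝ × ℝ → ℝ}

theorem tendsto_prodMk_nhdsWithin (u₀ t : ℝ) (s : Set ℝ) :
    Tendsto (fun θ : ℝ => (u₀, θ)) (𝓝[s] t) (𝓝 (u₀, t)) :=
  (Continuous.prodMk_right u₀).continuousAt.mono_left inf_le_left

theorem IsProjParam.eventually_proj_eq (hU : IsProjParam G Φ F u₀ t U) :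
    ∀ᶠ θ in 𝓝[Ici 0] t, 0 ≤ θ ∧
      proj (config G Φ θ) (F (u₀, t)) = F (U (u₀, θ), θ) := by
  filter_upwards [(tendsto_prodMk_nhdsWithin u₀ t (Ici 0)).eventually hU.proj_eq,
    self_mem_nhdsWithin] with θ h₁ h₂
  exact ⟨h₂, h₁ h₂⟩

theorem IsOrientedMotion.hasDerivWithinAt_projectedTangent (h : IsOrientedMotion G Φ c F)
    (ht : 0 ≤ t) (u₀ : ℝ) : HasDerivWithinAt (projectedTangent G Φ c (F (u₀, t)))
      (lagAngularVelocity F (u₀, t) • unitNormal F (u₀, t)) (Ici 0) t := by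
  have hm := (h.speed_pos ht u₀).ne'
  obtain ⟨U, hU⟩ := h.exists_isProjParam ht u₀
  have hd := h.hasDerivAt_unitTangent (h.hasDerivAt_projParam ht hU) (hasDerivAt_id' t)
    (by rwa [hU.apply_self])
  have heq : projectedTangent G Φ c (F (u₀, t)) =ᶠ[𝓝[Ici 0] t]
      fun θ => unitTangent F (U (u₀, θ), θ) := by
    filter_upwards [hU.eventually_proj_eq] with θ hθ
    rw [projectedTangent, hθ.2, h.tangent_eq hθ.1]
  have h1 := hd.hasDerivWithinAt (s := Ici 0) |>.congr_of_eventuallyEq heq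
    (heq.self_of_nhdsWithin ht)
  convert! h1 using 2
  · rw [hU.apply_self, lagAngularVelocity, lagCurvature]
    field_simp
    ring
  · rw [hU.apply_self]

theorem IsOrientedMotion.angularVelocity_eq (h : IsOrientedMotion G Φ c F)
    (ht : 0 ≤ t) (u₀ : ℝ) :
    angularVelocity G Φ c t (F (u₀, t)) = lagAngularVelocity F (u₀, t) := by
  rw [angularVelocity, (h.hasDerivWithinAt_projectedTangent ht u₀).derivWithin
    (uniqueDiffOn_Ici 0 t ht), h.normal_eq ht, real_inner_smul_left,
    inner_unitNormal_self (h.speed_pos ht u₀).ne', mul_one]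

theorem IsMotion.differentiableAt_lagCurvature (h : IsMotion G Φ F) {z : ℝ × ℝ}
    (hm : speed F z ≠ 0) : DifferentiableAt ℝ (lagCurvature F) z := by
  have p := fun i => h.d1_differentiable i z
  have p' := fun i => h.d1_d1_differentiable i z
  have hs : DifferentiableAt ℝ (speed F) z :=
    DifferentiableAt.sqrt (((p 0).fun_pow 2).fun_add ((p 1).fun_pow 2))
      fun h0 => hm (by rw [speed, h0, Real.sqrt_zero])
  have hn := ((p 0).fun_mul (p' 1)).fun_sub ((p 1).fun_mul (p' 0))
  have : lagCurvature F = fun z => (d1 (coord F 0) z * d1 (d1 (coord F 1)) z -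
      d1 (coord F 1) z * d1 (d1 (coord F 0)) z) * (speed F z ^ 3)⁻¹ :=
    funext fun z => div_eq_mul_inv _ _
  rw [this]
  exact hn.fun_mul ((hs.fun_pow 3).fun_inv (pow_ne_zero 3 hm))

/-- The algebra behind `ω'_ϱ`: `p, q` are the components of `F_u`, `xt, yt` those of `F_t`, a suffix
`1` or `t` means a further derivative in `u` or time, and `m` is the speed. The derivative `K` of
the curvature in `u` stays symbolic, as it occurs identically on both sides. -/
theorem rotation_identity {p q p1 q1 pt qt p1t q1t xt yt m K : ℝ} (hm : m ≠ 0)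
    (hsq : m ^ 2 = p ^ 2 + q ^ 2) :
    m⁻¹ * (((p1 * qt + p * q1t - (q1 * pt + q * p1t)) * m ^ 2 -
          (p * qt - q * pt) * (2 * (p * p1 + q * q1))) / m ^ 4 -
        (K * ((xt * p + yt * q) / m) + (p * q1 - q * p1) / m ^ 3 *
          (((pt * p + xt * p1 + (qt * q + yt * q1)) * m -
            (xt * p + yt * q) * ((p * p1 + q * q1) / m)) / m ^ 2))) =
      ((pt * q1 + p * q1t - (qt * p1 + q * p1t)) * m ^ 3 -
          (p * q1 - q * p1) * (3 * m ^ 2 * ((p * pt + q * qt) / m))) / m ^ 6 -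
        ((p * q1 - q * p1) / m ^ 3) ^ 2 * ((yt * p - xt * q) / m) -
        (xt * p + yt * q) / m / m * K := by
  field_simp
  have h4 : m ^ 4 = (p ^ 2 + q ^ 2) ^ 2 := by rw [← hsq]; ring
  grind

/-- The value is the rate of the curvature along the projection minus `κ² V_n`, the form required by
the curvature expansion. -/
theorem IsOrientedMotion.hasDerivAt_angularVelocity (h : IsOrientedMotion G Φ c F)
    (ht : 0 ≤ t) (u₀ : ℝ) : HasDerivAt (fun s => angularVelocity G Φ c t (c t s))
      (d2 (lagCurvature F) (u₀, t) - lagCurvature F (u₀, t) ^ 2 * lagNormalVelocity F (u₀, t) -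
        lagTangentialVelocity F (u₀, t) / speed F (u₀, t) * d1 (lagCurvature F) (u₀, t))
      (param (c t) (F (u₀, t))) := by
  have hm := (h.speed_pos ht u₀).ne'
  have hsq := speed_sq F (u₀, t)
  have hκ := h.differentiableAt_lagCurvature hm
  have hK := hasDerivAt_fst hκ
  have hM := h.hasDerivAt_speed (hasDerivAt_id' u₀) (hasDerivAt_const u₀ t) hm
  have hM' := h.hasDerivAt_speed (hasDerivAt_const t u₀) (hasDerivAt_id' t) hm
  simp only [zero_mul, one_mul, add_zero, zero_add] at hM hM'
  have p := fun i => hasDerivAt_fst (h.d1_differentiable i (u₀, t))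
  have v := fun i => hasDerivAt_fst (h.d2_differentiable i (u₀, t))
  have w := fun i => hasDerivAt_fst (h.d2_d1_differentiable i (u₀, t))
  have p' := fun i => hasDerivAt_snd (h.d1_differentiable i (u₀, t))
  have q' := fun i => hasDerivAt_snd (h.d1_d1_differentiable i (u₀, t))
  have hτ := (((v 0).fun_mul (p 0)).fun_add ((v 1).fun_mul (p 1))).fun_div hM hm
  have hβ := (((p 0).fun_mul (w 1)).fun_sub ((p 1).fun_mul (w 0))).fun_div (hM.fun_pow 2)
    (pow_ne_zero 2 hm)
  have hKθ := (hasDerivAt_snd hκ).unique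
    ((((p' 0).fun_mul (q' 1)).fun_sub ((p' 1).fun_mul (q' 0))).fun_div (hM'.fun_pow 3)
      (pow_ne_zero 3 hm))
  -- Exchanging these third-order derivatives is what makes the time derivative of the curvature
  -- appear.
  have hcomm : ∀ i, d1 (d2 (d1 (coord F i))) (u₀, t) = d2 (d1 (d1 (coord F i))) (u₀, t) :=
    fun i => d1_d2_comm (h.d1_contDiff i) _
  have h1 := h.hasDerivAt_arc ht (f := angularVelocity G Φ c t) (u := u₀)
    ((hβ.fun_sub (hK.fun_mul hτ)).congr_of_eventuallyEq
      (.of_forall fun x => h.angularVelocity_eq ht x))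
  convert! h1 using 1
  rw [hKθ, smul_eq_mul]
  simp only [lagTangentialVelocity, lagNormalVelocity, lagCurvature, h.d1_d2_coord, hcomm]
  have key := rotation_identity (p := d1 (coord F 0) (u₀, t)) (q := d1 (coord F 1) (u₀, t))
    (p1 := d1 (d1 (coord F 0)) (u₀, t)) (q1 := d1 (d1 (coord F 1)) (u₀, t))
    (pt := d2 (d1 (coord F 0)) (u₀, t)) (qt := d2 (d1 (coord F 1)) (u₀, t))
    (p1t := d2 (d1 (d1 (coord F 0))) (u₀, t)) (q1t := d2 (d1 (d1 (coord F 1))) (u₀, t))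
    (xt := d2 (coord F 0) (u₀, t)) (yt := d2 (coord F 1) (u₀, t)) (K := d1 (lagCurvature F) (u₀, t))
    hm hsq
  convert! key.symm using 1
  · push_cast
    field_simp
  · push_cast
    field_simp

theorem IsOrientedMotion.isLittleO_proj (h : IsOrientedMotion G Φ c F) (ht : 0 ≤ t) (u₀ : ℝ) :
    (fun θ => proj (config G Φ θ) (F (u₀, t)) - (F (u₀, t) +
      ((θ - t) * lagNormalVelocity F (u₀, t)) • unitNormal F (u₀, t)))
      =o[𝓝[Ici 0] t] (fun θ => θ - t) := by
  have hm := (h.speed_pos ht u₀).ne'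
  have hsq := speed_sq F (u₀, t)
  obtain ⟨U, hU⟩ := h.exists_isProjParam ht u₀
  have hd := hasDerivAt_curve (h.differentiable _) (h.hasDerivAt_projParam ht hU) (hasDerivAt_id' t)
  rw [hU.apply_self] at hd
  -- This is `V - V_τ τ = V_n n`.
  have hD : -(lagTangentialVelocity F (u₀, t) / speed F (u₀, t)) • d1 F (u₀, t) +
      (1 : ℝ) • d2 F (u₀, t) = lagNormalVelocity F (u₀, t) • unitNormal F (u₀, t) := by
    ext i
    fin_cases i
    · simp [h.d1_apply, h.d2_apply, unitNormal, lagTangentialVelocity, lagNormalVelocity]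
      field_simp
      rw [hsq]
      ring
    · simp [h.d1_apply, h.d2_apply, unitNormal, lagTangentialVelocity, lagNormalVelocity]
      field_simp
      rw [hsq]
      ring
  rw [hD] at hd
  simp only [mul_smul]
  refine isLittleO_of_eventuallyEq hd (by rw [hU.apply_self]) ?_
  filter_upwards [hU.eventually_proj_eq] with θ hθ using hθ.2

theorem IsOrientedMotion.isLittleO_curvature (h : IsOrientedMotion G Φ c F) (ht : 0 ≤ t)
    (u₀ : ℝ) :
    (fun θ => curvature (c θ) (proj (config G Φ θ) (F (u₀, t))) - (lagCurvature F (u₀, t) +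
      (d2 (lagCurvature F) (u₀, t) -
        lagTangentialVelocity F (u₀, t) / speed F (u₀, t) * d1 (lagCurvature F) (u₀, t)) * (θ - t)))
      =o[𝓝[Ici 0] t] (fun θ => θ - t) := by
  have hm := (h.speed_pos ht u₀).ne'
  obtain ⟨U, hU⟩ := h.exists_isProjParam ht u₀
  have hd := hasDerivAt_curve (f := lagCurvature F) (a := fun θ => U (u₀, θ)) (b := fun θ => θ)
    (by rw [hU.apply_self]; exact h.differentiableAt_lagCurvature hm)
    (h.hasDerivAt_projParam ht hU) (hasDerivAt_id' t)
  rw [hU.apply_self] at hd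
  have := isLittleO_of_eventuallyEq (s := Ici 0) hd (by rw [hU.apply_self])
    (f := fun θ => curvature (c θ) (proj (config G Φ θ) (F (u₀, t)))) (by
      filter_upwards [hU.eventually_proj_eq] with θ hθ
      rw [hθ.2, h.curvature_eq hθ.1])
  convert! this using 4
  simp only [smul_eq_mul]
  ring

/-- Along the projection `V` changes at the rate `A - V_τ V'_ϱ`, and `⟨V'_ϱ, n⟩ = ω + κ V_τ`; the
turning of `n` contributes a second `-ω V_τ`. -/
theorem IsOrientedMotion.isLittleO_normalVelocity (h : IsOrientedMotion G Φ c F) (ht : 0 ≤ t)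
    (u₀ : ℝ) :
    (fun θ => normalVelocity G Φ c θ (proj (config G Φ θ) (F (u₀, t))) -
      (lagNormalVelocity F (u₀, t) -
        (2 * lagAngularVelocity F (u₀, t) * lagTangentialVelocity F (u₀, t) -
          (d2 (d2 (coord F 1)) (u₀, t) * d1 (coord F 0) (u₀, t) -
            d2 (d2 (coord F 0)) (u₀, t) * d1 (coord F 1) (u₀, t)) / speed F (u₀, t) +
          lagCurvature F (u₀, t) * lagTangentialVelocity F (u₀, t) ^ 2) * (θ - t)))
      =o[𝓝[Ici 0] t] (fun θ => θ - t) := by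
  have hm := (h.speed_pos ht u₀).ne'
  have hsq := speed_sq F (u₀, t)
  obtain ⟨U, hU⟩ := h.exists_isProjParam ht u₀
  have hself := hU.apply_self
  have hUd := h.hasDerivAt_projParam ht hU
  set a := -(lagTangentialVelocity F (u₀, t) / speed F (u₀, t)) with ha
  have hM := h.hasDerivAt_speed hUd (hasDerivAt_id' t) (by rwa [hself])
  have p := fun i => hasDerivAt_curve (a := fun θ => U (u₀, θ)) (b := fun θ => θ)
    (h.d1_differentiable i _) hUd (hasDerivAt_id' t)
  have v := fun i => hasDerivAt_curve (a := fun θ => U (u₀, θ)) (b := fun θ => θ)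
    (h.d2_differentiable i _) hUd (hasDerivAt_id' t)
  have hd := (((v 1).fun_mul (p 0)).fun_sub ((v 0).fun_mul (p 1))).fun_div hM (by rwa [hself])
  have := isLittleO_of_eventuallyEq (s := Ici 0) hd rfl
    (f := fun θ => normalVelocity G Φ c θ (proj (config G Φ θ) (F (u₀, t)))) (by
      filter_upwards [hU.eventually_proj_eq] with θ hθ
      rw [hθ.2, h.normalVelocity_eq hθ.1, lagNormalVelocity])
  convert! this using 3
  simp only [hself, smul_eq_mul, h.d1_d2_coord, one_mul]
  rw [sub_eq_add_neg, ← neg_mul, mul_comm _ (_ - t)]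
  congr 2
  rw [ha]
  simp only [lagAngularVelocity, lagTangentialVelocity, lagCurvature]
  field_simp
  have h4 : speed F (u₀, t) ^ 4 = (d1 (coord F 0) (u₀, t) ^ 2 + d1 (coord F 1) (u₀, t) ^ 2) ^ 2 := by
    rw [← hsq]; ring
  grind

end

/-! ### Stretch of the projection -/

section

variable {G : Set Plane} {Φ : Plane → ℝ → Plane} {F : ℝ × ℝ → Plane} {c : ℝ → ℝ → Plane}
  {t u₀ : ℝ} {U : ℝ × ℝ → ℝ}

/-- The derivative of the equation of the projection with respect to the Lagrangian parameter. -/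
noncomputable def projSlope (F : ℝ × ℝ → Plane) (u₀ t : ℝ) (z : ℝ × ℝ) : ℝ :=
  d1 (coord F 0) z ^ 2 + d1 (coord F 1) z ^ 2 +
    ((coord F 0 z - coord F 0 (u₀, t)) * d1 (d1 (coord F 0)) z +
      (coord F 1 z - coord F 1 (u₀, t)) * d1 (d1 (coord F 1)) z)

/-- Implicit differentiation in `x`. `IsProjParam` gives only `C^1` for `U`, so `d1 U` need not be
differentiable in time a priori; this equation writes it as a quotient of differentiable functions.
-/
theorem IsMotion.d1_projParam (h : IsMotion G Φ F) (hU : IsProjParam G Φ F u₀ t U) :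
    ∀ᶠ θ in 𝓝 t, HasDerivAt (fun x => U (x, θ)) (d1 U (u₀, θ)) u₀ ∧
      d1 U (u₀, θ) * projSlope F u₀ t (U (u₀, θ), θ) =
        d1 (coord F 0) (u₀, t) * d1 (coord F 0) (U (u₀, θ), θ) +
          d1 (coord F 1) (u₀, t) * d1 (coord F 1) (U (u₀, θ), θ) := by
  have hc : Tendsto (fun θ : ℝ => (u₀, θ)) (𝓝 t) (𝓝 (u₀, t)) :=
    (Continuous.prodMk_right u₀).continuousAt
  filter_upwards [hc.eventually (eventually_eventually_nhds.2 hU.projEq_eq),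
    hc.eventually (hU.contDiffAt.eventually (by simp))] with θ h₁ h₂
  have hd := hasDerivAt_fst (h₂.differentiableAt one_ne_zero)
  refine ⟨hd, ?_⟩
  have hx : Tendsto (fun x : ℝ => (x, θ)) (𝓝 u₀) (𝓝 (u₀, θ)) :=
    (Continuous.prodMk_left θ).continuousAt
  have x := fun i => hasDerivAt_curve (a := fun x => U (x, θ)) (b := fun _ => θ)
    (h.coord_differentiable i _) hd (hasDerivAt_const u₀ θ)
  have x' := fun i => hasDerivAt_fst (h.coord_differentiable i (u₀, t))
  have p := fun i => hasDerivAt_curve (a := fun x => U (x, θ)) (b := fun _ => θ)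
    (h.d1_differentiable i _) hd (hasDerivAt_const u₀ θ)
  have hz := ((((x 0).fun_sub (x' 0)).fun_mul (p 0)).fun_add
    (((x 1).fun_sub (x' 1)).fun_mul (p 1))).congr_of_eventuallyEq (f₁ := fun _ => (0 : ℝ)) (by
      filter_upwards [hx.eventually h₁] with y hy
      exact hy.symm)
  have h3 := hz.unique (hasDerivAt_const u₀ 0)
  simp only [smul_eq_mul, zero_mul, add_zero] at h3
  rw [projSlope]
  linear_combination h3

theorem IsOrientedMotion.hasDerivAt_proj (h : IsOrientedMotion G Φ c F) (ht : 0 ≤ t)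
    (hU : IsProjParam G Φ F u₀ t U) : ∀ᶠ θ in 𝓝[Ici 0] t,
      HasDerivAt (fun s => proj (config G Φ θ) (c t s))
        ((speed F (u₀, t))⁻¹ • d1 U (u₀, θ) • d1 F (U (u₀, θ), θ)) (param (c t) (F (u₀, t))) := by
  filter_upwards [nhdsWithin_le_nhds (h.d1_projParam hU),
    (tendsto_prodMk_nhdsWithin u₀ t (Ici 0)).eventually (eventually_eventually_nhds.2 hU.proj_eq),
    self_mem_nhdsWithin] with θ h₁ h₂ h₃
  have hd := hasDerivAt_curve (h.differentiable _) h₁.1 (hasDerivAt_const u₀ θ)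
  rw [zero_smul, add_zero] at hd
  have hx : Tendsto (fun x : ℝ => (x, θ)) (𝓝 u₀) (𝓝 (u₀, θ)) :=
    (Continuous.prodMk_left θ).continuousAt
  refine h.hasDerivAt_arc ht (f := proj (config G Φ θ)) (hd.congr_of_eventuallyEq ?_)
  filter_upwards [hx.eventually h₂] with x hx using hx h₃

theorem IsOrientedMotion.isLittleO_norm_arcDeriv_proj (h : IsOrientedMotion G Φ c F) (ht : 0 ≤ t)
    (u₀ : ℝ) :
    (fun θ => ‖arcDeriv (c t) (fun x => proj (config G Φ θ) x) (F (u₀, t))‖ - 1 -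
      (-(lagCurvature F (u₀, t) * lagNormalVelocity F (u₀, t)) * (θ - t)))
      =o[𝓝[Ici 0] t] (fun θ => θ - t) := by
  have hm := (h.speed_pos ht u₀).ne'
  have hsq := speed_sq F (u₀, t)
  obtain ⟨U, hU⟩ := h.exists_isProjParam ht u₀
  have hself := hU.apply_self
  have hUd := h.hasDerivAt_projParam ht hU
  set a := -(lagTangentialVelocity F (u₀, t) / speed F (u₀, t)) with ha
  have hM := h.hasDerivAt_speed hUd (hasDerivAt_id' t) (by rwa [hself])
  have x := fun i => hasDerivAt_curve (a := fun θ => U (u₀, θ)) (b := fun θ => θ)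
    (h.coord_differentiable i _) hUd (hasDerivAt_id' t)
  have p := fun i => hasDerivAt_curve (a := fun θ => U (u₀, θ)) (b := fun θ => θ)
    (h.d1_differentiable i _) hUd (hasDerivAt_id' t)
  have p' := fun i => hasDerivAt_curve (a := fun θ => U (u₀, θ)) (b := fun θ => θ)
    (h.d1_d1_differentiable i _) hUd (hasDerivAt_id' t)
  have hnum := ((p 0).const_mul (d1 (coord F 0) (u₀, t))).fun_add
    ((p 1).const_mul (d1 (coord F 1) (u₀, t)))
  have hden : HasDerivAt (fun θ => projSlope F u₀ t (U (u₀, θ), θ)) _ t :=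
    (((p 0).fun_pow 2).fun_add ((p 1).fun_pow 2)).fun_add
      ((((x 0).sub_const (coord F 0 (u₀, t))).fun_mul (p' 0)).fun_add
        (((x 1).sub_const (coord F 1 (u₀, t))).fun_mul (p' 1)))
  have hden0 : projSlope F u₀ t (U (u₀, t), t) = speed F (u₀, t) ^ 2 := by
    rw [hself, projSlope, hsq]; ring
  have hnum0 : d1 (coord F 0) (u₀, t) * d1 (coord F 0) (U (u₀, t), t) +
      d1 (coord F 1) (u₀, t) * d1 (coord F 1) (U (u₀, t), t) = speed F (u₀, t) ^ 2 := by
    rw [hself, hsq]; ring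
  have hpos : 0 < speed F (u₀, t) ^ 2 := pow_pos (h.speed_pos ht u₀) 2
  have hd := (hnum.fun_mul hM).fun_div (hden.mul_const (speed F (u₀, t)))
    (by rw [hden0]; positivity)
  have heq := isLittleO_of_eventuallyEq (s := Ici 0) (y := 1) hd
    (by simp only [hnum0, hden0]; rw [hself]; exact div_self (mul_ne_zero hpos.ne' hm))
    (f := fun θ => ‖arcDeriv (c t) (fun x => proj (config G Φ θ) x) (F (u₀, t))‖) (by
      filter_upwards [h.hasDerivAt_proj ht hU, nhdsWithin_le_nhds (h.d1_projParam hU),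
        nhdsWithin_le_nhds (hden.continuousAt.eventually_const_lt (hpos.trans_eq hden0.symm)),
        nhdsWithin_le_nhds (hnum.continuousAt.eventually_const_lt (hpos.trans_eq hnum0.symm))]
        with θ h₁ h₂ h₃ h₄
      -- Both terms of the quotient equal `speed ^ 2` at `θ = t`, so `d1 U > 0` nearby and the norm
      -- needs no absolute value.
      have h₅ := eq_div_of_mul_eq h₃.ne' h₂.2
      rw [arcDeriv, h₁.deriv, norm_smul, norm_smul, h.norm_d1, norm_inv, Real.norm_eq_abs,
        Real.norm_eq_abs, abs_of_pos (h.speed_pos ht u₀), h₅, abs_of_pos (div_pos h₄ h₃)]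
      field_simp)
  convert! heq using 2
  rw [sub_sub, smul_eq_mul, mul_comm _ (_ - t)]
  congr 3
  rw [hden0, hnum0]
  simp only [hself, smul_eq_mul, sub_self, zero_mul, add_zero, one_mul, ha]
  simp only [lagNormalVelocity, lagTangentialVelocity, lagCurvature]
  push_cast
  field_simp
  have h4 : speed F (u₀, t) ^ 4 = (d1 (coord F 0) (u₀, t) ^ 2 + d1 (coord F 1) (u₀, t) ^ 2) ^ 2 := by
    rw [← hsq]; ring
  grind

end

/-! ### Arc length and the rate of stretch -/

section

variable {G : Set Plane} {Φ : Plane → ℝ → Plane} {F : ℝ × ℝ → Plane} {c : ℝ → ℝ → Plane}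
  {t u₀ : ℝ}

/-- The arc length from the parameter `0` to the parameter `u` at the time `θ`. -/
noncomputable def arcLen (F : ℝ × ℝ → Plane) (θ u : ℝ) : ℝ := ∫ v in (0 : ℝ)..u, speed F (v, θ)

theorem IsMotion.continuous_speed (h : IsMotion G Φ F) : Continuous (speed F) := by
  have := fun i => (h.d1_contDiff i).continuous
  exact (((this 0).pow 2).add ((this 1).pow 2)).sqrt

theorem IsMotion.continuous_arcLen (h : IsMotion G Φ F) :
    Continuous fun z : ℝ × ℝ => arcLen F z.1 z.2 := by
  have hs := h.continuous_speed
  exact intervalIntegral.continuous_parametric_primitive_of_continuous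
    (f := fun θ v => speed F (v, θ)) (hs.comp (continuous_snd.prodMk continuous_fst))

theorem IsMotion.hasDerivAt_arcLen (h : IsMotion G Φ F) (θ u : ℝ) :
    HasDerivAt (arcLen F θ) (speed F (u, θ)) u := by
  have hs : Continuous fun v => speed F (v, θ) :=
    h.continuous_speed.comp (Continuous.prodMk_left θ)
  exact (hs.integral_hasStrictDerivAt 0 u).hasDerivAt

theorem IsMotion.strictMono_arcLen (h : IsMotion G Φ F) {θ : ℝ} (hθ : 0 ≤ θ) :
    StrictMono (arcLen F θ) :=
  strictMono_of_deriv_pos fun u => by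
    rw [(h.hasDerivAt_arcLen θ u).deriv]; exact h.speed_pos hθ u

theorem IsMotion.arcLen_add_int (h : IsMotion G Φ F) {θ : ℝ} (hθ : 0 ≤ θ) (u : ℝ) (k : ℤ) :
    arcLen F θ (u + k) = arcLen F θ u + k * arcLen F θ 1 := by
  have hs : Continuous fun v => speed F (v, θ) :=
    h.continuous_speed.comp (Continuous.prodMk_left θ)
  have hper : Function.Periodic (fun v => speed F (v, θ)) 1 := fun v => by
    have := h.d1_periodic_int hθ v 1
    simp only [Int.cast_one] at this
    simp only [← h.norm_d1, this]
  have h1 := hper.intervalIntegral_add_zsmul_eq k u fun a b => hs.intervalIntegrable a b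
  rw [hper.intervalIntegral_add_eq u 0, zero_add] at h1
  have h2 := intervalIntegral.integral_add_adjacent_intervals
    (hs.intervalIntegrable (μ := MeasureTheory.volume) 0 u) (hs.intervalIntegrable u (u + k))
  simp only [zsmul_eq_mul, mul_one] at h1
  rw [h1] at h2
  exact h2.symm

theorem IsMotion.arcLen_lift (h : IsMotion G Φ F) {θ : ℝ} (hθ : 0 ≤ θ) {γ : ℝ → Plane}
    {w : ℝ → ℝ} (hw : IsLift (fun u => F (u, θ)) γ 1 w) (s s' : ℝ) :
    arcLen F θ (w s') - arcLen F θ (w s) = s' - s := by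
  have hd : ∀ s, HasDerivAt (fun s => arcLen F θ (w s) - s) 0 s := by
    intro s
    have h1 := (h.hasDerivAt_arcLen θ (w s)).comp s (hw s).2
    rw [h.deriv_eq, h.norm_d1, mul_one_div_cancel (h.speed_pos hθ _).ne'] at h1
    have h2 := h1.sub (hasDerivAt_id' s)
    rw [sub_self] at h2
    exact h2
  have := is_const_of_deriv_eq_zero (fun s => (hd s).differentiableAt) (fun s => (hd s).deriv) s' s
  linarith

/-- The natural parameter is `arcLen` along the lift up to a constant, and `F` determines its
parameter modulo `1`, so arcs differ by full turns. -/
theorem IsOrientedMotion.mem_arcLengths_iff (h : IsOrientedMotion G Φ c F) {θ : ℝ} (hθ : 0 ≤ θ)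
    (u u' l : ℝ) : l ∈ arcLengths (c θ) (F (u, θ)) (F (u', θ)) ↔
      ∃ k : ℤ, l = arcLen F θ u' - arcLen F θ u + k * arcLen F θ 1 := by
  obtain ⟨w, hw⟩ := h.exists_lift θ hθ
  constructor
  · rintro ⟨a, ha, ha'⟩
    obtain ⟨k, hk⟩ := h.eq_add_int θ hθ u (w a) (ha.symm.trans (hw a).1.symm)
    obtain ⟨k', hk'⟩ := h.eq_add_int θ hθ u' (w (a + l)) (ha'.symm.trans (hw _).1.symm)
    have h1 := h.arcLen_lift hθ hw a (a + l)
    rw [hk, hk', h.arcLen_add_int hθ, h.arcLen_add_int hθ] at h1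
    refine ⟨k' - k, ?_⟩
    push_cast
    linarith
  · rintro ⟨k, rfl⟩
    have hmem : F (u, θ) ∈ range (c θ) := by
      rw [(h.natural θ hθ).range_eq, ← h.range_eq θ hθ]; exact mem_range_self u
    obtain ⟨a, ha⟩ := hmem
    obtain ⟨j, hj⟩ := h.eq_add_int θ hθ u (w a) (ha.symm.trans (hw a).1.symm)
    refine ⟨a, ha, ?_⟩
    set l := arcLen F θ u' - arcLen F θ u + k * arcLen F θ 1
    have h1 := h.arcLen_lift hθ hw a (a + l)
    have h2 : w (a + l) = u' + (j + k : ℤ) := by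
      apply (h.strictMono_arcLen hθ).injective
      rw [hj, h.arcLen_add_int hθ] at h1
      rw [h.arcLen_add_int hθ]
      push_cast
      linarith
    rw [← (hw _).1, h2]
    exact h.periodic_int hθ u' _

/-- Below half the total length, any extra turn makes the arc strictly longer; the minimizer is
unique and the choice in `signedLength` is forced. -/
theorem IsOrientedMotion.signedLength_eq (h : IsOrientedMotion G Φ c F) {θ : ℝ} (hθ : 0 ≤ θ)
    {u u' : ℝ} (hlt : 2 * |arcLen F θ u' - arcLen F θ u| < arcLen F θ 1) :
    signedLength (c θ) (F (u, θ)) (F (u', θ)) = arcLen F θ u' - arcLen F θ u := by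
  set l := arcLen F θ u' - arcLen F θ u with hl
  set L := arcLen F θ 1
  have hlow : ∀ k : ℤ, k ≠ 0 → |l| < |l + k * L| := by
    intro k hk
    have hk1 : (1 : ℝ) ≤ |(k : ℝ)| := by exact_mod_cast Int.one_le_abs hk
    have hL : 0 < L := (mul_nonneg zero_le_two (abs_nonneg l)).trans_lt hlt
    have h1 : L ≤ |(k : ℝ) * L| := by
      rw [abs_mul, abs_of_pos hL]
      exact le_mul_of_one_le_left hL.le hk1
    have h2 : |(k : ℝ) * L| ≤ |l + k * L| + |l| := by
      have := abs_sub (l + k * L) l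
      rwa [add_sub_cancel_left] at this
    linarith
  have hex : ∃ m ∈ arcLengths (c θ) (F (u, θ)) (F (u', θ)),
      ∀ m' ∈ arcLengths (c θ) (F (u, θ)) (F (u', θ)), |m| ≤ |m'| := by
    refine ⟨l, (h.mem_arcLengths_iff hθ u u' l).2 ⟨0, by simp [hl]⟩, fun m' hm' => ?_⟩
    obtain ⟨k, rfl⟩ := (h.mem_arcLengths_iff hθ u u' m').1 hm'
    by_cases hk : k = 0
    · simp [hk, hl]
    · exact (hlow k hk).le
  rw [signedLength, dif_pos hex]
  obtain ⟨hm, hmin⟩ := hex.choose_spec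
  obtain ⟨k, hk⟩ := (h.mem_arcLengths_iff hθ u u' _).1 hm
  have h1 := hmin l ((h.mem_arcLengths_iff hθ u u' l).2 ⟨0, by simp [hl]⟩)
  by_cases hk0 : k = 0
  · rw [hk, hk0]; simp [hl]
  · rw [hk] at h1
    exact absurd h1 (not_le.2 (hlow k hk0))

/-- The derivative of the speed with respect to time. -/
noncomputable def speedRate (F : ℝ × ℝ → Plane) (z : ℝ × ℝ) : ℝ :=
  (d1 (coord F 0) z * d2 (d1 (coord F 0)) z + d1 (coord F 1) z * d2 (d1 (coord F 1)) z) / speed F z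

theorem IsMotion.hasDerivAt_speed_time (h : IsMotion G Φ F) {u θ : ℝ} (hm : speed F (u, θ) ≠ 0) :
    HasDerivAt (fun θ => speed F (u, θ)) (speedRate F (u, θ)) θ := by
  simpa only [zero_mul, one_mul, zero_add, speedRate] using
    h.hasDerivAt_speed (hasDerivAt_const θ u) (hasDerivAt_id' θ) hm

theorem IsMotion.continuousAt_speedRate (h : IsMotion G Φ F) {z : ℝ × ℝ} (hm : speed F z ≠ 0) :
    ContinuousAt (speedRate F) z := by
  have a := fun i => (h.d1_contDiff i).continuous.continuousAt (x := z)
  have b := fun i => (h.d2_d1_differentiable i).continuous.continuousAt (x := z)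
  exact (((a 0).mul (b 0)).add ((a 1).mul (b 1))).div h.continuous_speed.continuousAt hm

/-- The mean value inequality in time, with a bound uniform in `u`; this uniformity is what permits
a simultaneous double limit. -/
theorem IsMotion.speed_ratio_bound (h : IsMotion G Φ F) (ht : 0 ≤ t) (u₀ : ℝ) {ε : ℝ}
    (hε : 0 < ε) : ∃ η > 0, ∀ u θ, |u - u₀| < η → |θ - t| < η →
      |speed F (u, θ) / speed F (u, t) - 1 -
        speedRate F (u₀, t) / speed F (u₀, t) * (θ - t)| ≤ ε * |θ - t| := by
  have hm := (h.speed_pos ht u₀).ne'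
  set σ := speedRate F (u₀, t) / speed F (u₀, t)
  have hs := h.continuous_speed
  have hcont : ContinuousAt (fun z : ℝ × ℝ => speedRate F z / speed F (z.1, t)) (u₀, t) := by
    refine (h.continuousAt_speedRate hm).div ?_ hm
    exact (hs.comp (continuous_fst.prodMk continuous_const)).continuousAt
  have e₁ : ∀ᶠ z : ℝ × ℝ in 𝓝 (u₀, t), |speedRate F z / speed F (z.1, t) - σ| < ε :=
    hcont (Metric.ball_mem_nhds σ hε)
  have e₂ : ∀ᶠ z : ℝ × ℝ in 𝓝 (u₀, t), speed F z ≠ 0 := hs.continuousAt.eventually_ne hm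
  obtain ⟨η, hη, hball⟩ := Metric.eventually_nhds_iff.1 (e₁.and e₂)
  refine ⟨η, hη, fun u θ hu hθ => ?_⟩
  have hut := (h.speed_pos ht u).ne'
  have hd : ∀ x ∈ Metric.ball t η, HasDerivWithinAt
      (fun x => speed F (u, x) / speed F (u, t) - 1 - σ * (x - t))
      (speedRate F (u, x) / speed F (u, t) - σ) (Metric.ball t η) x := by
    intro x hx
    have h1 := hball (y := (u, x)) (max_lt hu hx)
    have h2 := (h.hasDerivAt_speed_time h1.2).div_const (speed F (u, t))
    have h3 := (h2.sub_const 1).sub (((hasDerivAt_id' x).sub_const t).const_mul σ)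
    rw [mul_one] at h3
    exact h3.hasDerivWithinAt
  have := Convex.norm_image_sub_le_of_norm_hasDerivWithin_le hd
    (fun x hx => (hball (y := (u, x)) (max_lt hu hx)).1.le) (convex_ball t η)
    (Metric.mem_ball_self hη) (show θ ∈ Metric.ball t η from hθ)
  simpa [div_self hut] using this

/-- The error `L - δ - σ (θ - t) δ` vanishes at `δ = 0`, and its derivative in `δ` is the quantity
bounded by `IsMotion.speed_ratio_bound`. A mean value inequality in `δ` bounds the error by `(ε / 2)
|θ - t| |δ|`. -/
theorem IsOrientedMotion.hasStretchRate (h : IsOrientedMotion G Φ c F) (ht : 0 ≤ t) (u₀ : ℝ) :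
    HasStretchRate G Φ c t (F (u₀, t)) (speedRate F (u₀, t) / speed F (u₀, t)) := by
  set σ := speedRate F (u₀, t) / speed F (u₀, t) with hσ
  obtain ⟨w, hw, hwu⟩ := h.exists_lift_at ht u₀
  set s₀ := param (c t) (F (u₀, t)) with hs₀
  have hwd : ∀ s, HasDerivAt w (speed F (w s, t))⁻¹ s := fun s => by
    have := (hw s).2
    rwa [h.deriv_eq, h.norm_d1, one_div] at this
  have hwc : Continuous w := continuous_iff_continuousAt.2 fun s => (hwd s).continuousAt
  have hD : ∀ θ δ, HasDerivAt
      (fun δ => arcLen F θ (w (s₀ + δ)) - arcLen F θ u₀ - δ - σ * (θ - t) * δ)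
      (speed F (w (s₀ + δ), θ) / speed F (w (s₀ + δ), t) - 1 - σ * (θ - t)) δ := by
    intro θ δ
    have h1 := (h.hasDerivAt_arcLen θ (w (s₀ + δ))).comp δ ((hwd (s₀ + δ)).comp_const_add s₀ δ)
    have h2 := ((h1.sub_const (arcLen F θ u₀)).sub (hasDerivAt_id' δ)).sub
      ((hasDerivAt_id' δ).const_mul (σ * (θ - t)))
    rw [mul_one] at h2
    exact h2
  have hshort : ∀ᶠ z : ℝ × ℝ in 𝓝 t ×ˢ 𝓝 0,
      2 * |arcLen F z.1 (w (s₀ + z.2)) - arcLen F z.1 u₀| < arcLen F z.1 1 := by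
    rw [← nhds_prod_eq]
    have hc := h.continuous_arcLen
    have c₁ : Continuous fun z : ℝ × ℝ =>
        2 * |arcLen F z.1 (w (s₀ + z.2)) - arcLen F z.1 u₀| := by
      have a₁ : Continuous fun z : ℝ × ℝ => arcLen F z.1 (w (s₀ + z.2)) :=
        hc.comp (continuous_fst.prodMk (hwc.comp (continuous_const.add continuous_snd)))
      have a₂ : Continuous fun z : ℝ × ℝ => arcLen F z.1 u₀ :=
        hc.comp (continuous_fst.prodMk continuous_const)
      exact continuous_const.mul (a₁.sub a₂).abs
    have c₂ : Continuous fun z : ℝ × ℝ => arcLen F z.1 1 :=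
      hc.comp (continuous_fst.prodMk continuous_const)
    refine c₁.continuousAt.eventually_lt c₂.continuousAt ?_
    have : arcLen F t 0 < arcLen F t 1 := h.strictMono_arcLen ht one_pos
    simpa [hwu, arcLen] using this
  have hle : 𝓝[Ici 0 \ {t}] t ×ˢ 𝓝[≠] (0 : ℝ) ≤ 𝓝 t ×ˢ 𝓝 0 :=
    prod_mono nhdsWithin_le_nhds nhdsWithin_le_nhds
  refine Metric.tendsto_nhds.2 fun ε hε => ?_
  obtain ⟨η, hη, hbound⟩ := h.speed_ratio_bound ht u₀ (half_pos hε)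
  obtain ⟨η', hη', hball⟩ : ∃ η' > 0, ∀ δ, |δ| < η' → |w (s₀ + δ) - u₀| < η := by
    have hc : ContinuousAt (fun δ => w (s₀ + δ)) 0 := by fun_prop
    obtain ⟨η', hη', hb⟩ := Metric.continuousAt_iff.1 hc η hη
    refine ⟨η', hη', fun δ hδ => ?_⟩
    have := hb (x := δ) (by simpa using hδ)
    simpa [Real.dist_eq, hwu] using this
  have f₁ : ∀ᶠ θ in 𝓝[Ici 0 \ {t}] t, (0 ≤ θ ∧ θ ≠ t) ∧ |θ - t| < η :=
    Eventually.and self_mem_nhdsWithin (nhdsWithin_le_nhds (Metric.ball_mem_nhds t hη))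
  have f₂ : ∀ᶠ δ in 𝓝[≠] (0 : ℝ), δ ≠ 0 ∧ |δ| < η' :=
    Eventually.and self_mem_nhdsWithin (nhdsWithin_le_nhds (by
      simpa [Metric.ball, Real.dist_eq] using Metric.ball_mem_nhds (0 : ℝ) hη'))
  filter_upwards [hle hshort, f₁.prod_mk f₂] with z hz₁ hz₂
  obtain ⟨θ, δ⟩ := z
  obtain ⟨⟨⟨h0, hne⟩, hθ⟩, hδ0, hδ⟩ := hz₂
  simp only at hz₁ h0 hne hθ hδ0 hδ ⊢
  have hadv : advance (c t) (F (u₀, t)) δ = F (w (s₀ + δ), t) := ((hw _).1).symm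
  rw [hadv, h.location_eq t ht θ h0, h.location_eq t ht θ h0, h.signedLength_eq h0 hz₁]
  have hmvt := Convex.norm_image_sub_le_of_norm_hasDerivWithin_le (s := Metric.ball (0 : ℝ) η')
    (fun x _ => (hD θ x).hasDerivWithinAt)
    (fun x hx => hbound _ _ (hball x (by simpa using hx)) hθ) (convex_ball 0 η')
    (Metric.mem_ball_self hη') (show δ ∈ Metric.ball 0 η' by simpa using hδ)
  simp only [add_zero, hwu, sub_self, mul_zero, sub_zero, Real.norm_eq_abs] at hmvt
  have hpos : 0 < |(θ - t) * δ| := abs_pos.2 (mul_ne_zero (sub_ne_zero.2 hne) hδ0)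
  rw [Real.dist_eq]
  have hquot : (arcLen F θ (w (s₀ + δ)) - arcLen F θ u₀ - δ) / ((θ - t) * δ) - σ =
      (arcLen F θ (w (s₀ + δ)) - arcLen F θ u₀ - δ - σ * (θ - t) * δ) / ((θ - t) * δ) := by
    have := abs_pos.1 hpos
    rw [eq_div_iff this, sub_mul, div_mul_cancel₀ _ this]
    ring
  rw [hquot, abs_div, div_lt_iff₀ hpos]
  refine hmvt.trans_lt ?_
  rw [mul_assoc, ← abs_mul]
  exact mul_lt_mul_of_pos_right (half_lt_self hε) hpos

end

end PlanarCurve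

/-! ### Assembly of the theorem -/

theorem mainTheorem2
    (G O : Set PlanarCurve.Plane) (Φ : PlanarCurve.Plane → ℝ → PlanarCurve.Plane)
    (hΦ : PlanarCurve.IsConfiguration G O Φ)
    (c : ℝ → ℝ → PlanarCurve.Plane)
    (hc : ∀ t, 0 ≤ t → PlanarCurve.IsNaturalParam (PlanarCurve.config G Φ t) (c t))
    (t : ℝ) (ht : 0 ≤ t)
    (r : PlanarCurve.Plane) (hr : r ∈ PlanarCurve.config G Φ t) :
    let Γ := PlanarCurve.config G Φ
    let π := fun (x : PlanarCurve.Plane) (θ : ℝ) => PlanarCurve.proj (Γ θ) x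
    let n := PlanarCurve.normal (c t) r
    let τ := PlanarCurve.tangent (c t) r
    let κ := PlanarCurve.curvature (c t) r
    let V := PlanarCurve.velocity G Φ t
    let V_n := PlanarCurve.normalVelocity G Φ c t r
    let V_τ := PlanarCurve.tangentialVelocity G Φ c t r
    let A_n := PlanarCurve.normalAcceleration G Φ c t r
    let ω := PlanarCurve.angularVelocity G Φ c t
    -- the projection is well defined near the point and the time
    (∀ᶠ z : PlanarCurve.Plane × ℝ in 𝓝[Γ t] r ×ˢ 𝓝[Ici 0] t,
      ∃! p, PlanarCurve.IsNearest (Γ z.2) z.1 p) ∧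
    -- the derivatives that enter the formulas exist
    (∀ᶠ θ in 𝓝[Ici 0] t, PlanarCurve.ArcDifferentiableAt (c t) (fun x => π x θ) r) ∧
    PlanarCurve.ArcDifferentiableAt (c t) V r ∧
    DifferentiableWithinAt ℝ (PlanarCurve.projectedTangent G Φ c r) (Ici 0) t ∧
    PlanarCurve.ArcDifferentiableAt (c t) ω r ∧
    -- motion of the projection
    (fun θ => π r θ - (r + ((θ - t) * V_n) • n)) =o[𝓝[Ici 0] t] (fun θ => θ - t) ∧
    -- stretch of the projection
    (fun θ => ‖PlanarCurve.arcDeriv (c t) (fun x => π x θ) r‖ - 1 - (-(κ * V_n) * (θ - t)))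
      =o[𝓝[Ici 0] t] (fun θ => θ - t) ∧
    -- increment of the curvature along the projection
    (fun θ => PlanarCurve.curvature (c θ) (π r θ) -
        (κ + (PlanarCurve.arcDeriv (c t) ω r + κ ^ 2 * V_n) * (θ - t)))
      =o[𝓝[Ici 0] t] (fun θ => θ - t) ∧
    -- increment of the normal velocity along the projection
    (fun θ => PlanarCurve.normalVelocity G Φ c θ (π r θ) -
        (V_n - (2 * ω r * V_τ - A_n + κ * V_τ ^ 2) * (θ - t)))
      =o[𝓝[Ici 0] t] (fun θ => θ - t) ∧
    -- rate of stretch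
    PlanarCurve.HasStretchRate G Φ c t r (inner ℝ τ (PlanarCurve.arcDeriv (c t) V r)) ∧
    -- angular velocity
    ω r = inner ℝ n (PlanarCurve.arcDeriv (c t) V r) - κ * V_τ := by
  intro Γ π n τ κ V V_n V_τ A_n ω
  obtain ⟨F, hF, hlift⟩ := hΦ.exists_motion_lift hc
  have h : PlanarCurve.IsOrientedMotion G Φ c F := ⟨hF, hc, hlift⟩
  obtain ⟨u₀, rfl⟩ : ∃ u, F (u, t) = r := by
    rw [← hF.range_eq t ht] at hr
    exact hr
  have hω : ∀ u, ω (F (u, t)) = PlanarCurve.lagAngularVelocity F (u, t) :=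
    fun u => h.angularVelocity_eq ht u
  have hdω := h.hasDerivAt_angularVelocity ht u₀
  obtain ⟨U, hU⟩ := h.exists_isProjParam ht u₀
  refine ⟨h.eventually_existsUnique_isNearest ht u₀,
    (h.hasDerivAt_proj ht hU).mono fun θ hθ => hθ.differentiableAt,
    (h.hasDerivAt_velocity ht u₀).differentiableAt,
    (h.hasDerivWithinAt_projectedTangent ht u₀).differentiableWithinAt,
    hdω.differentiableAt, ?_, ?_, ?_, ?_, ?_, ?_⟩
  · simp only [V_n, n, h.normalVelocity_eq ht, h.normal_eq ht]
    exact h.isLittleO_proj ht u₀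
  · simp only [κ, V_n, h.curvature_eq ht, h.normalVelocity_eq ht]
    exact h.isLittleO_norm_arcDeriv_proj ht u₀
  · have hval : PlanarCurve.arcDeriv (c t) ω (F (u₀, t)) = _ := hdω.deriv
    simp only [κ, V_n, h.curvature_eq ht, h.normalVelocity_eq ht, hval]
    -- Adding `κ² V_n` to `ω'_ϱ` cancels its last term and leaves the rate of the curvature along
    -- the projection.
    convert! h.isLittleO_curvature ht u₀ using 5
    ring
  · simp only [V_n, V_τ, A_n, κ, hω, h.curvature_eq ht, h.normalVelocity_eq ht,
      h.tangentialVelocity_eq ht, h.normalAcceleration_eq ht]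
    exact h.isLittleO_normalVelocity ht u₀
  · rw [h.inner_tangent_arcDeriv_velocity ht u₀]
    convert! h.hasStretchRate ht u₀ using 1
    rw [PlanarCurve.speedRate, div_div, pow_two]
  · rw [hω]
    exact (h.inner_normal_arcDeriv_velocity ht u₀).symm
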